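/- **Setting.** A process is a probability measure $\mu$ on $[0,1]^{\mathbb N}$, $\mathbb N=\{1,2,\dots\}$, with its product $\sigma$-algebra; $\mathbf X=(X_1,X_2,\dots)$ are the coordinate maps. It is *stationary* if $(X_1,\dots,X_k)$ and $(X_{1+i},\dots,X_{k+i})$ have the same law for all $i,k$. For $\sigma$-subalgebras $\mathfrak U,\mathfrak V$ let $$\beta(\mathfrak U,\mathfrak V):=\sup_{W\in\mathfrak U\otimes\mathfrak V}|\mu_\otimes(W)-(\mu_{\mathfrak U}\times\mu_{\mathfrak V})(W)|,$$ where $\mu_\otimes$ is the push-forward of $\mu$ under $\omega\mapsto(\omega,\omega)$ and $\mu_{\mathfrak U},\mu_{\mathfrak V}$ are the restrictions of $\mu$ to $\mathfrak U,\mathfrak V$. For $m\in\mathbb N$ put $$\beta(m):=\sup_{j\ge1}\beta\big(\sigma(X_t:1\le t\le j),\,\sigma(X_t:t\ge j+m)\big),\qquad \|\boldsymbol\beta\|:=\sum_{m\ge1}\beta(m)\in[0,\infty].$$ The process is *$\beta$-mixing* if $\beta(m)\to0$. **Estimators.** Let $\Delta_{k,\ell}$ be the partition of $[0,1]^k$ into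 the $2^{k\ell}$ products of dyadic intervals $[i2^{-\ell},(i+1)2^{-\ell})$, $0\le i<2^\ell$, where the last interval ($i=2^\ell-1$) also contains the point $1$. For $A\subseteq[0,1]^k$ put $\mu_t(\mathbf X,A):=\frac1t\sum_{i=0}^{t-1}\chi_A(X_{ik+1},\dots,X_{(i+1)k})$. For $n>m$, $1\le j\le n-m$ and $j':=n-m-j+1$, let $$\gamma^{m,j}_{t,n}(\mathbf X,A,B):=\frac1t\sum_{i=0}^{t-1}\chi_A(X_{in+1},\dots,X_{in+j})\,\chi_B(X_{in+j+m},\dots,X_{(i+1)n}),$$ $$\widehat\beta^{\,\ell}_{t,n}(\mathbf X,m):=\max_{1\le j\le n-m}\frac12\sum_{A\in\Delta_{j,\ell}}\sum_{B\in\Delta_{j',\ell}}\big|\gamma^{m,j}_{t,n}(\mathbf X,A,B)-\mu_t(\mathbf X,A)\,\mu_t(\mathbf X,B)\big|,$$ and $\widehat\beta^{\,\ell}_{t,n}(\mathbf X,m):=0$ if $n\le m$. Let $(\ell_t),(n_t),(M_t)$ be non-decreasing unbounded sequences of positive integers, $(\delta_t)$ a summable sequence of positive reals, and $(\epsilon_t)$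 a sequence of positive reals with $\epsilon_t\to0$. With $\widetilde C_{m,\ell,n}:=m\,2^{\,2^{2n\ell+1}+2^{m\ell+1}+2}$ put $$\widetilde\tau_t:=\Big\lceil\frac{\widetilde C_{m,\ell_t,n_t}}{m\,\epsilon_t^2\delta_t}\Big\rceil,\quad \widetilde\kappa_t:=\Big\lceil\frac{\widetilde C_{M_t,\ell_t,n_t}}{\epsilon_t^2\delta_t}\Big\rceil,\quad \widehat\beta_t(\mathbf X,m):=\widehat\beta^{\,\ell_t}_{\widetilde\tau_t,n_t}(\mathbf X,m),\quad \widetilde\theta_t(\mathbf X):=\sum_{m=1}^{M_t}\widehat\beta^{\,\ell_t}_{\widetilde\kappa_t,n_t}(\mathbf X,m).$$ **Theorem.** Let $\mathbf X$ be a stationary $\beta$-mixing process with distribution $\mu$ such that $\|\boldsymbol\beta\|<\infty$. Then, for each $m\in\mathbb N$, $$\lim_{t\to\infty}\widehat\beta_t(\mathbf X,m)=\beta(m)\quad\mu\text{-almost surely},$$ and $$\lim_{t\to\infty}\widetilde\theta_t(\mathbf X)=\|\boldsymbol\beta\|\quad\mu\text{-almost surely}.$$ -/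

import Mathlib

open MeasureTheory Filter Topology
open scoped ENNReal

noncomputable section

namespace BetaMixing

/-! ### The β-dependence of two sub-σ-algebras -/

section Dependence

variable {Ω : Type*} {F : MeasurableSpace Ω}

/-- The pushforward `μ_⊗` of `μ` under the diagonal injection `ω ↦ (ω, ω)`, a measure on
`(Ω × Ω, U ⊗ V)`. -/
def diagMeasure (μ : Measure Ω) (U V : MeasurableSpace Ω) :
    @Measure (Ω × Ω) (MeasurableSpace.prod U V) :=
  @Measure.map Ω (Ω × Ω) F (MeasurableSpace.prod U V) (fun ω => (ω, ω)) μ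

/-- The product `μ_U × μ_V` of the restrictions of `μ` to the σ-algebras `U` and `V`, a measure
on `(Ω × Ω, U ⊗ V)`. -/
def restrProd (μ : Measure Ω) {U V : MeasurableSpace Ω} (hU : U ≤ F) (hV : V ≤ F) :
    @Measure (Ω × Ω) (MeasurableSpace.prod U V) :=
  @Measure.prod Ω Ω U V (μ.trim hU) (μ.trim hV)

/-- `β(U, V) = sup_{W ∈ U ⊗ V} |μ_⊗(W) - (μ_U × μ_V)(W)|`. -/
def betaDep (μ : Measure Ω) {U V : MeasurableSpace Ω} (hU : U ≤ F) (hV : V ≤ F) : ℝ :=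
  ⨆ W : {W : Set (Ω × Ω) // MeasurableSet[MeasurableSpace.prod U V] W},
    |(diagMeasure μ U V W.1).toReal - (restrProd μ hU hV W.1).toReal|

theorem diagMeasure_apply (μ : Measure Ω) {U V : MeasurableSpace Ω} (hU : U ≤ F) (hV : V ≤ F)
    {W : Set (Ω × Ω)} (hW : MeasurableSet[MeasurableSpace.prod U V] W) :
    diagMeasure μ U V W = μ {ω | (ω, ω) ∈ W} := by
  unfold diagMeasure
  have hm : @Measurable Ω (Ω × Ω) F (MeasurableSpace.prod U V) (fun ω => (ω, ω)) :=
    (measurable_id'' hU).prodMk (measurable_id'' hV)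
  rw [@Measure.map_apply Ω (Ω × Ω) F (MeasurableSpace.prod U V) μ _ hm W hW]
  rfl

theorem restrProd_le_one (μ : Measure Ω) [IsProbabilityMeasure μ] {U V : MeasurableSpace Ω}
    (hU : U ≤ F) (hV : V ≤ F) (W : Set (Ω × Ω)) : restrProd μ hU hV W ≤ 1 := by
  have h1 : @IsProbabilityMeasure Ω U (μ.trim hU) :=
    ⟨by rw [trim_measurableSet_eq hU MeasurableSet.univ, measure_univ]⟩
  have h2 : @IsProbabilityMeasure Ω V (μ.trim hV) :=
    ⟨by rw [trim_measurableSet_eq hV MeasurableSet.univ, measure_univ]⟩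
  have h3 : @IsProbabilityMeasure (Ω × Ω) (MeasurableSpace.prod U V) (restrProd μ hU hV) :=
    @Measure.prod.instIsProbabilityMeasure Ω Ω U V _ _ h1 h2
  exact (@measure_mono _ _ _ _ _ _ _ (Set.subset_univ W)).trans_eq h3.measure_univ

/-- Every term of the supremum in `betaDep` is at most `1`, so that supremum is a genuine one. -/
theorem betaDep_term_le_one (μ : Measure Ω) [IsProbabilityMeasure μ] {U V : MeasurableSpace Ω}
    (hU : U ≤ F) (hV : V ≤ F) {W : Set (Ω × Ω)}
    (hW : MeasurableSet[MeasurableSpace.prod U V] W) :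
    |(diagMeasure μ U V W).toReal - (restrProd μ hU hV W).toReal| ≤ 1 := by
  have h1 : (diagMeasure μ U V W).toReal ≤ 1 := by
    rw [diagMeasure_apply μ hU hV hW]
    exact ENNReal.toReal_le_of_le_ofReal zero_le_one (by simpa using prob_le_one)
  have h2 : (restrProd μ hU hV W).toReal ≤ 1 :=
    ENNReal.toReal_le_of_le_ofReal zero_le_one (by simpa using restrProd_le_one μ hU hV W)
  have h3 : 0 ≤ (diagMeasure μ U V W).toReal := ENNReal.toReal_nonneg
  have h4 : 0 ≤ (restrProd μ hU hV W).toReal := ENNReal.toReal_nonneg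
  rw [abs_le]
  constructor <;> linarith

theorem betaDep_le_one (μ : Measure Ω) [IsProbabilityMeasure μ] {U V : MeasurableSpace Ω}
    (hU : U ≤ F) (hV : V ≤ F) : betaDep μ hU hV ≤ 1 :=
  Real.iSup_le (fun W => betaDep_term_le_one μ hU hV W.2) zero_le_one

end Dependence

/-! ### Processes with values in `[0,1]` and their β-mixing coefficients -/

/-- The space of sample paths `(X₁, X₂, …)` with values in `[0,1]`. A process is a probability
measure on this space with its product σ-algebra. -/
abbrev Path : Type := ℕ → unitInterval

/-- The coordinate process `X₁, X₂, …`. The time index `t` starts at `1`, while the entries of a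
path are numbered from `0`; the index `t = 0` is never used. -/
def X (t : ℕ) (ω : Path) : unitInterval := ω (t - 1)

theorem measurable_X (t : ℕ) : Measurable (X t) := measurable_pi_apply (t - 1)

/-- Stationarity: `(X₁, …, X_k)` and `(X_{1+i}, …, X_{k+i})` have the same law. -/
def IsStationary (μ : Measure Path) : Prop :=
  ∀ (i k : ℕ) (B : Set (Fin k → unitInterval)), MeasurableSet B →
    μ {ω | (fun r : Fin k => X (1 + r) ω) ∈ B} = μ {ω | (fun r : Fin k => X (1 + i + r) ω) ∈ B}

/-- The σ-algebra `σ({X_t : t ∈ T})`. -/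
@[reducible] def sigmaX (T : Set ℕ) : MeasurableSpace Path :=
  ⨆ t ∈ T, MeasurableSpace.comap (X t) inferInstance

theorem sigmaX_le (T : Set ℕ) : sigmaX T ≤ (inferInstance : MeasurableSpace Path) :=
  iSup₂_le fun t _ => (measurable_X t).comap_le

/-- The β-mixing coefficient
`β(m) = sup_{j ≥ 1} β(σ({X_t : 1 ≤ t ≤ j}), σ({X_t : t ≥ j + m}))`, for `m ≥ 1`. -/
def betaMixing (μ : Measure Path) (m : ℕ) : ℝ :=
  ⨆ j : {j : ℕ // 1 ≤ j},
    betaDep μ (sigmaX_le (Set.Icc 1 j.1)) (sigmaX_le (Set.Ici (j.1 + m)))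

/-- A process is β-mixing if `β(m) → 0`. -/
def IsBetaMixing (μ : Measure Path) : Prop :=
  Tendsto (fun m => betaMixing μ m) atTop (𝓝 0)

/-- `‖β‖ = ∑_{m ≥ 1} β(m)`, as an element of `[0, ∞]`. -/
def betaNorm (μ : Measure Path) : ℝ≥0∞ :=
  ∑' m : ℕ, ENNReal.ofReal (betaMixing μ (m + 1))

/-! ### The estimators -/

/-- The dyadic interval `[i / 2^ℓ, (i+1) / 2^ℓ)`; the last one, `i = 2^ℓ - 1`, also contains the
point `1`, so that these intervals partition `[0,1]`. -/
def dyadicInterval (ℓ : ℕ) (i : Fin (2 ^ ℓ)) : Set unitInterval :=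
  {x | (i : ℝ) / 2 ^ ℓ ≤ (x : ℝ) ∧ ((x : ℝ) < ((i : ℝ) + 1) / 2 ^ ℓ ∨ (i : ℕ) + 1 = 2 ^ ℓ)}

/-- The dyadic cube of side length `2^{-ℓ}` in `[0,1]^k` with index `c`. -/
def dyadicCube {k : ℕ} (ℓ : ℕ) (c : Fin k → Fin (2 ^ ℓ)) : Set (Fin k → unitInterval) :=
  {x | ∀ r, x r ∈ dyadicInterval ℓ (c r)}

/-- The block `(X_a, X_{a+1}, …, X_{a+k-1})` of the path `ω`. -/
def block (a k : ℕ) (ω : Path) : Fin k → unitInterval := fun r => X (a + r) ω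

/-- The empirical measure
`μ_t(X, B) = (1/t) ∑_{i=0}^{t-1} χ_B(X_{ik+1}, …, X_{(i+1)k})`. -/
def empMeasure (t : ℕ) (ω : Path) {k : ℕ} (B : Set (Fin k → unitInterval)) : ℝ :=
  (1 / (t : ℝ)) * ∑ i ∈ Finset.range t, B.indicator (fun _ => (1 : ℝ)) (block (i * k + 1) k ω)

/-- The empirical joint frequency
`γ(X, A, B) = (1/t) ∑_{i=0}^{t-1} χ_A(X_{in+1}, …, X_{in+j}) χ_B(X_{in+j+m}, …, X_{(i+1)n})`;
here `B` is a set of vectors of length `j' = n - m - j + 1`. -/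
def empJoint (t n m : ℕ) (ω : Path) {j j' : ℕ} (A : Set (Fin j → unitInterval))
    (B : Set (Fin j' → unitInterval)) : ℝ :=
  (1 / (t : ℝ)) * ∑ i ∈ Finset.range t,
    A.indicator (fun _ => (1 : ℝ)) (block (i * n + 1) j ω) *
      B.indicator (fun _ => (1 : ℝ)) (block (i * n + j + m) j' ω)

/-- The empirical estimate `β̂_{t,n}^ℓ(X, m)`: the maximum over `j ∈ {1, …, n - m}` of
`(1/2) ∑_A ∑_B |γ(X, A, B) - μ_t(X, A) μ_t(X, B)|`, where `A` and `B` run over the dyadic cubes of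
side length `2^{-ℓ}` in dimensions `j` and `j' = n - m - j + 1`. It is `0` if `n ≤ m`. -/
def betaHat (t n ℓ : ℕ) (ω : Path) (m : ℕ) : ℝ :=
  ⨆ j : {j : ℕ // j ∈ Finset.Icc 1 (n - m)},
    (1 / 2 : ℝ) * ∑ a : Fin j.1 → Fin (2 ^ ℓ), ∑ b : Fin (n - m - j.1 + 1) → Fin (2 ^ ℓ),
      |empJoint t n m ω (dyadicCube ℓ a) (dyadicCube ℓ b)
        - empMeasure t ω (dyadicCube ℓ a) * empMeasure t ω (dyadicCube ℓ b)|

/-- The constant `C̃_{m,ℓ,n} = m 2^{2^{2nℓ+1} + 2^{mℓ+1} + 2}`. -/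
def Ctilde (m ℓ n : ℕ) : ℝ :=
  (m : ℝ) * 2 ^ (2 ^ (2 * n * ℓ + 1) + 2 ^ (m * ℓ + 1) + 2)

/-- The number of blocks `τ̃ = C̃_{m,ℓ,n} / (m ε² δ)`, rounded up to an integer. -/
def tauTilde (m ℓ n : ℕ) (ε δ : ℝ) : ℕ := ⌈Ctilde m ℓ n / (m * ε ^ 2 * δ)⌉₊

/-- The number of blocks `κ̃ = C̃_{M,ℓ,n} / (ε² δ)`, rounded up to an integer. -/
def kappaTilde (M ℓ n : ℕ) (ε δ : ℝ) : ℕ := ⌈Ctilde M ℓ n / (ε ^ 2 * δ)⌉₊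

/-- The estimator `β̂_t(X, m)` of `β(m)`. -/
def betaEst (ℓ n : ℕ → ℕ) (ε δ : ℕ → ℝ) (t : ℕ) (ω : Path) (m : ℕ) : ℝ :=
  betaHat (tauTilde m (ℓ t) (n t) (ε t) (δ t)) (n t) (ℓ t) ω m

/-- The estimator `θ̃_t(X)` of `‖β‖`. -/
def thetaEst (ℓ n M : ℕ → ℕ) (ε δ : ℕ → ℝ) (t : ℕ) (ω : Path) : ℝ :=
  ∑ m ∈ Finset.Icc 1 (M t),
    betaHat (kappaTilde (M t) (ℓ t) (n t) (ε t) (δ t)) (n t) (ℓ t) ω m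

end BetaMixing

end

noncomputable section

namespace BetaMixing

/-! ### Approximation by sets from an increasing sequence of σ-algebras -/

/-! The error splits into a deterministic and a random part, with `betaCell` in between: the
dependence of the dyadic quantizations of `X₁, …, X_j` and `X_{j+m}, …, X_n`, maximized over `j`.

Deterministic part. On a finite partition the supremum defining the β-dependence is half an ℓ¹
distance, so `betaCell` never exceeds `β(m)` (`betaCell_le_betaMixing`). Dyadic cells generate the
product σ-algebra, so a nearly optimal `W` is nearly a union of cells, and `betaCell` climbs to
`β(m)` as the resolution and the window grow (`eventually_lt_betaCell`).

Random part. Every frequency in the estimator averages indicators of consecutive disjoint blocks.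
The covariance of two such indicators is at most `β` at their gap, and the gaps from a fixed block
to the later ones are distinct. Finiteness of `‖β‖` therefore bounds the variance by `(1 + 2‖β‖)/t`
(`variance_sum_blockIndicator_le`). Chebyshev and a union bound over cells and over `j` control the
distance from the estimator to `betaCell` (`measure_betaHat_deviation_le`). The block counts are
large enough that a deviation beyond `ε_t` has probability at most a constant times `δ_t`, and
Borel–Cantelli applies.

For the norm, the inequality `betaCell ≤ β(m)` supplies a summable majorant, so dominated
convergence passes the limit through the sum (`tendsto_sum_betaCell`). -/

theorem isSetRing_iUnion_measurableSet {α : Type*} {G : ℕ → MeasurableSpace α}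
    (hG : Monotone G) : IsSetRing (⋃ N, {s | MeasurableSet[G N] s}) where
  empty_mem := Set.mem_iUnion.2 ⟨0, @MeasurableSet.empty _ (G 0)⟩
  union_mem := by
    intro s t hs ht
    obtain ⟨i, hi⟩ := Set.mem_iUnion.1 hs
    obtain ⟨j, hj⟩ := Set.mem_iUnion.1 ht
    exact Set.mem_iUnion.2 ⟨max i j, @MeasurableSet.union _ (G (max i j)) _ _
      (hG (le_max_left i j) _ hi) (hG (le_max_right i j) _ hj)⟩
  sdiff_mem := by
    intro s t hs ht
    obtain ⟨i, hi⟩ := Set.mem_iUnion.1 hs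
    obtain ⟨j, hj⟩ := Set.mem_iUnion.1 ht
    exact Set.mem_iUnion.2 ⟨max i j, @MeasurableSet.diff _ (G (max i j)) _ _
      (hG (le_max_left i j) _ hi) (hG (le_max_right i j) _ hj)⟩

/-- If an increasing sequence of σ-algebras generates, every measurable set is approximated
simultaneously in two finite measures by a set measurable at a finite stage. -/
theorem exists_abs_measureReal_sub_lt {α : Type*} {mα : MeasurableSpace α} (μ ν : Measure α)
    [IsFiniteMeasure μ] [IsFiniteMeasure ν] {G : ℕ → MeasurableSpace α} (hG : Monotone G)
    (h : mα = ⨆ N, G N) {s : Set α} (hs : MeasurableSet s) {ε : ℝ} (hε : 0 < ε) :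
    ∃ N t, MeasurableSet[G N] t ∧ |μ.real t - μ.real s| < ε ∧ |ν.real t - ν.real s| < ε := by
  have hgen : mα = MeasurableSpace.generateFrom (⋃ N, {s | MeasurableSet[G N] s}) :=
    h.trans (MeasurableSpace.generateFrom_iUnion_measurableSet G).symm
  -- Approximating in `μ + ν` makes one set serve both measures, each being dominated by the sum.
  obtain ⟨t, ht, hlt⟩ := exists_measure_symmDiff_lt_of_generateFrom_isSetRing (μ := μ + ν)
    (isSetRing_iUnion_measurableSet hG)
    ⟨{Set.univ}, Set.countable_singleton _, by
      rintro _ rfl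
      exact Set.mem_iUnion.2 ⟨0, @MeasurableSet.univ _ (G 0)⟩, by simp⟩
    hgen hs (ENNReal.ofReal_pos.2 hε)
  obtain ⟨N, hN⟩ := Set.mem_iUnion.1 ht
  have htm : MeasurableSet t := by
    rw [h]; exact le_iSup G N _ hN
  have key : ∀ ρ : Measure α, IsFiniteMeasure ρ → ρ ≤ μ + ν → |ρ.real t - ρ.real s| < ε := by
    intro ρ _ hρ
    refine (abs_measureReal_sub_le_measureReal_symmDiff htm.nullMeasurableSet
      hs.nullMeasurableSet).trans_lt ?_
    exact (ENNReal.lt_ofReal_iff_toReal_lt (measure_ne_top _ _)).1 ((hρ _).trans_lt hlt)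
  exact ⟨N, t, hN, key μ inferInstance (Measure.le_add_right le_rfl),
    key ν inferInstance (Measure.le_add_left le_rfl)⟩

/-! ### The β-dependence along finite partitions -/

section Partition

variable {α β : Type*}

theorem measureReal_preimage_prod_eq_sum {A B : Type*} {mA : MeasurableSpace A}
    {mB : MeasurableSpace B} (ν : Measure (A × B)) [IsFiniteMeasure ν] {f : A → α} {g : B → β}
    (hf : ∀ a, MeasurableSet {x | f x = a}) (hg : ∀ b, MeasurableSet {y | g y = b})
    (S : Finset (α × β)) :
    ν.real {p | (f p.1, g p.2) ∈ S} = ∑ q ∈ S, ν.real ({x | f x = q.1} ×ˢ {y | g y = q.2}) := by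
  have : {p : A × B | (f p.1, g p.2) ∈ S}
      = ⋃ q ∈ S, ({x | f x = q.1} ×ˢ {y | g y = q.2} : Set (A × B)) := by
    ext p
    simp only [Set.mem_ofPred_eq, Set.mem_iUnion, Set.mem_prod, exists_prop]
    constructor
    · exact fun hp => ⟨_, hp, rfl, rfl⟩
    · rintro ⟨⟨a, b⟩, hq, rfl, rfl⟩
      exact hq
  rw [this, measureReal_biUnion_finset]
  · intro q _ q' _ hqq
    refine Set.disjoint_left.2 ?_
    rintro p ⟨h1, h2⟩ ⟨h3, h4⟩
    exact hqq (Prod.ext (h1.symm.trans h3) (h2.symm.trans h4))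
  · exact fun q _ => (hf q.1).prod (hg q.2)

/-- The sums over `S` and its complement are opposite, so each has at most half of the total
absolute mass. -/
theorem abs_sum_le_half_sum_abs {ι : Type*} [Fintype ι] {d : ι → ℝ} (hd : ∑ i, d i = 0)
    (S : Finset ι) : |∑ i ∈ S, d i| ≤ 1 / 2 * ∑ i, |d i| := by
  classical
  have h1 := Finset.sum_add_sum_compl S d
  have h2 := Finset.sum_add_sum_compl S fun i => |d i|
  have h3 := Finset.abs_sum_le_sum_abs d S
  have h4 := Finset.abs_sum_le_sum_abs d Sᶜ
  rw [show ∑ i ∈ Sᶜ, d i = -∑ i ∈ S, d i by linarith, abs_neg] at h4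
  linarith

/-- Positive and negative parts have equal mass, so the bound of `abs_sum_le_half_sum_abs` is
attained on the nonnegative indices. -/
theorem half_sum_abs_eq_sum_nonneg {ι : Type*} [Fintype ι] {d : ι → ℝ} (hd : ∑ i, d i = 0) :
    1 / 2 * ∑ i, |d i| = ∑ i with 0 ≤ d i, d i := by
  have h1 := Finset.sum_filter_add_sum_filter_not Finset.univ (fun i => 0 ≤ d i) d
  have h2 := Finset.sum_filter_add_sum_filter_not Finset.univ (fun i => 0 ≤ d i) fun i => |d i|
  have h3 : ∑ i with 0 ≤ d i, |d i| = ∑ i with 0 ≤ d i, d i :=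
    Finset.sum_congr rfl fun i hi => abs_of_nonneg (Finset.mem_filter.1 hi).2
  have h4 : ∑ i with ¬ 0 ≤ d i, |d i| = -∑ i with ¬ 0 ≤ d i, d i := by
    rw [← Finset.sum_neg_distrib]
    exact Finset.sum_congr rfl fun i hi =>
      abs_of_neg (not_le.1 (Finset.mem_filter.1 hi).2)
  linarith

variable {Ω : Type*} {F : MeasurableSpace Ω}

theorem isProbabilityMeasure_diagMeasure (μ : Measure Ω) [IsProbabilityMeasure μ]
    {U V : MeasurableSpace Ω} (hU : U ≤ F) (hV : V ≤ F) :
    @IsProbabilityMeasure (Ω × Ω) (MeasurableSpace.prod U V) (diagMeasure μ U V) :=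
  ⟨by rw [diagMeasure_apply μ hU hV MeasurableSet.univ]; simp⟩

theorem isProbabilityMeasure_restrProd (μ : Measure Ω) [IsProbabilityMeasure μ]
    {U V : MeasurableSpace Ω} (hU : U ≤ F) (hV : V ≤ F) :
    @IsProbabilityMeasure (Ω × Ω) (MeasurableSpace.prod U V) (restrProd μ hU hV) := by
  have h1 : @IsProbabilityMeasure Ω U (μ.trim hU) :=
    ⟨by rw [trim_measurableSet_eq hU MeasurableSet.univ, measure_univ]⟩
  have h2 : @IsProbabilityMeasure Ω V (μ.trim hV) :=
    ⟨by rw [trim_measurableSet_eq hV MeasurableSet.univ, measure_univ]⟩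
  exact @Measure.prod.instIsProbabilityMeasure Ω Ω U V _ _ h1 h2

theorem restrProd_prod (μ : Measure Ω) [IsProbabilityMeasure μ] {U V : MeasurableSpace Ω}
    (hU : U ≤ F) (hV : V ≤ F) {E E' : Set Ω} (hE : MeasurableSet[U] E)
    (hE' : MeasurableSet[V] E') : restrProd μ hU hV (E ×ˢ E') = μ E * μ E' := by
  have h2 : @IsProbabilityMeasure Ω V (μ.trim hV) :=
    ⟨by rw [trim_measurableSet_eq hV MeasurableSet.univ, measure_univ]⟩
  have := @Measure.prod_prod Ω Ω U V (μ.trim hU) (μ.trim hV) inferInstance E E'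
  rw [trim_measurableSet_eq hU hE, trim_measurableSet_eq hV hE'] at this
  exact this

theorem abs_sub_le_betaDep (μ : Measure Ω) [IsProbabilityMeasure μ] {U V : MeasurableSpace Ω}
    (hU : U ≤ F) (hV : V ≤ F) {W : Set (Ω × Ω)}
    (hW : MeasurableSet[MeasurableSpace.prod U V] W) :
    |(diagMeasure μ U V W).toReal - (restrProd μ hU hV W).toReal| ≤ betaDep μ hU hV :=
  le_ciSup (f := fun W : {W : Set (Ω × Ω) // MeasurableSet[MeasurableSpace.prod U V] W} =>
    |(diagMeasure μ U V W.1).toReal - (restrProd μ hU hV W.1).toReal|)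
    ⟨1, by rintro _ ⟨W, rfl⟩; exact betaDep_term_le_one μ hU hV W.2⟩ ⟨W, hW⟩

theorem betaDep_nonneg (μ : Measure Ω) {U V : MeasurableSpace Ω} (hU : U ≤ F) (hV : V ≤ F) :
    0 ≤ betaDep μ hU hV :=
  Real.iSup_nonneg fun _ => abs_nonneg _

theorem abs_measureReal_inter_sub_le_betaDep (μ : Measure Ω) [IsProbabilityMeasure μ]
    {U V : MeasurableSpace Ω} (hU : U ≤ F) (hV : V ≤ F) {E E' : Set Ω}
    (hE : MeasurableSet[U] E) (hE' : MeasurableSet[V] E') :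
    |μ.real (E ∩ E') - μ.real E * μ.real E'| ≤ betaDep μ hU hV := by
  have hW : MeasurableSet[MeasurableSpace.prod U V] (E ×ˢ E') :=
    @MeasurableSet.prod Ω Ω U V _ _ hE hE'
  have := abs_sub_le_betaDep μ hU hV hW
  rw [restrProd_prod μ hU hV hE hE', diagMeasure_apply μ hU hV hW, ENNReal.toReal_mul] at this
  exact this

/-- The deviation from independence of the events `f = a` and `g = b`. -/
def jointDev (μ : Measure Ω) (f : Ω → α) (g : Ω → β) (q : α × β) : ℝ :=
  μ.real {ω | f ω = q.1 ∧ g ω = q.2} - μ.real {ω | f ω = q.1} * μ.real {ω | g ω = q.2}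

theorem measurableSet_preimage_prod {U V : MeasurableSpace Ω} {f : Ω → α} {g : Ω → β}
    (hf : ∀ a, MeasurableSet[U] {x | f x = a})
    (hg : ∀ b, MeasurableSet[V] {y | g y = b}) (S : Finset (α × β)) :
    MeasurableSet[MeasurableSpace.prod U V] {p : Ω × Ω | (f p.1, g p.2) ∈ S} := by
  have : {p : Ω × Ω | (f p.1, g p.2) ∈ S}
      = ⋃ q ∈ S, ({x | f x = q.1} ×ˢ {y | g y = q.2} : Set (Ω × Ω)) := by
    ext p
    simp only [Set.mem_ofPred_eq, Set.mem_iUnion, Set.mem_prod, exists_prop]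
    constructor
    · exact fun hp => ⟨_, hp, rfl, rfl⟩
    · rintro ⟨⟨a, b⟩, hq, rfl, rfl⟩
      exact hq
  rw [this]
  exact @Finset.measurableSet_biUnion _ _ (MeasurableSpace.prod U V) _ S
    fun q _ => @MeasurableSet.prod Ω Ω U V _ _ (hf q.1) (hg q.2)

/-- Both measures are additive over the disjoint rectangles `{f = a} × {g = b}`, and on each
rectangle their difference is one `jointDev`. -/
theorem diag_sub_restrProd_eq_sum_jointDev (μ : Measure Ω) [IsProbabilityMeasure μ]
    {U V : MeasurableSpace Ω} (hU : U ≤ F) (hV : V ≤ F) {f : Ω → α} {g : Ω → β}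
    (hf : ∀ a, MeasurableSet[U] {x | f x = a})
    (hg : ∀ b, MeasurableSet[V] {y | g y = b}) (S : Finset (α × β)) :
    (diagMeasure μ U V {p : Ω × Ω | (f p.1, g p.2) ∈ S}).toReal
      - (restrProd μ hU hV {p : Ω × Ω | (f p.1, g p.2) ∈ S}).toReal
      = ∑ q ∈ S, jointDev μ f g q := by
  have i1 := isProbabilityMeasure_diagMeasure μ hU hV
  have i2 := isProbabilityMeasure_restrProd μ hU hV
  have h1 := @measureReal_preimage_prod_eq_sum α β Ω Ω U V (diagMeasure μ U V)
    inferInstance f g hf hg S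
  have h2 := @measureReal_preimage_prod_eq_sum α β Ω Ω U V (restrProd μ hU hV)
    inferInstance f g hf hg S
  unfold Measure.real at h1 h2
  rw [h1, h2, ← Finset.sum_sub_distrib]
  refine Finset.sum_congr rfl fun q _ => ?_
  rw [restrProd_prod μ hU hV (hf _) (hg _), diagMeasure_apply μ hU hV
    (@MeasurableSet.prod Ω Ω U V _ _ (hf q.1) (hg q.2)), ENNReal.toReal_mul]
  rfl

theorem sum_jointDev_eq_zero [Fintype α] [Fintype β] (μ : Measure Ω) [IsProbabilityMeasure μ]
    {U V : MeasurableSpace Ω} (hU : U ≤ F) (hV : V ≤ F) {f : Ω → α} {g : Ω → β}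
    (hf : ∀ a, MeasurableSet[U] {x | f x = a})
    (hg : ∀ b, MeasurableSet[V] {y | g y = b}) : ∑ q, jointDev μ f g q = 0 := by
  have i1 := isProbabilityMeasure_diagMeasure μ hU hV
  have i2 := isProbabilityMeasure_restrProd μ hU hV
  rw [← diag_sub_restrProd_eq_sum_jointDev μ hU hV hf hg Finset.univ]
  have : {p : Ω × Ω | (f p.1, g p.2) ∈ (Finset.univ : Finset (α × β))} = Set.univ := by
    ext; simp
  rw [this, i1.measure_univ, i2.measure_univ, sub_self]

/-- The union of the cells with nonnegative deviation is one of the competitors `W`. -/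
theorem half_sum_jointDev_le_betaDep [Fintype α] [Fintype β] (μ : Measure Ω) [IsProbabilityMeasure μ]
    {U V : MeasurableSpace Ω} (hU : U ≤ F) (hV : V ≤ F) {f : Ω → α} {g : Ω → β}
    (hf : ∀ a, MeasurableSet[U] {x | f x = a})
    (hg : ∀ b, MeasurableSet[V] {y | g y = b}) :
    1 / 2 * ∑ q, |jointDev μ f g q| ≤ betaDep μ hU hV := by
  rw [half_sum_abs_eq_sum_nonneg (sum_jointDev_eq_zero μ hU hV hf hg),
    ← diag_sub_restrProd_eq_sum_jointDev μ hU hV hf hg]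
  exact (le_abs_self _).trans
    (abs_sub_le_betaDep μ hU hV (measurableSet_preimage_prod hf hg _))

theorem abs_diag_sub_restrProd_le_half_sum_jointDev [Fintype α] [Fintype β]
    (μ : Measure Ω) [IsProbabilityMeasure μ]
    {U V : MeasurableSpace Ω} (hU : U ≤ F) (hV : V ≤ F) {f : Ω → α} {g : Ω → β}
    (hf : ∀ a, MeasurableSet[U] {x | f x = a}) (hg : ∀ b, MeasurableSet[V] {y | g y = b})
    (S : Set (α × β)) :
    |(diagMeasure μ U V {p : Ω × Ω | (f p.1, g p.2) ∈ S}).toReal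
      - (restrProd μ hU hV {p : Ω × Ω | (f p.1, g p.2) ∈ S}).toReal|
      ≤ 1 / 2 * ∑ q, |jointDev μ f g q| := by
  classical
  have h := diag_sub_restrProd_eq_sum_jointDev μ hU hV hf hg S.toFinset
  simp only [Set.mem_toFinset] at h
  rw [h]
  exact abs_sum_le_half_sum_abs (sum_jointDev_eq_zero μ hU hV hf hg) _

end Partition

/-! ### Dyadic quantization -/

/-- The index of the dyadic interval of length `2^{-ℓ}` containing `x`. -/
def quant (ℓ : ℕ) (x : unitInterval) : Fin (2 ^ ℓ) :=
  ⟨min ⌊(x : ℝ) * 2 ^ ℓ⌋₊ (2 ^ ℓ - 1),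
    (min_le_right _ _).trans_lt (Nat.sub_lt (by positivity) one_pos)⟩

/-- The minimum in `quant` only acts at `x = 1`, whose floor `2 ^ ℓ` is moved back to the last
index; this matches the closed last interval. -/
theorem mem_dyadicInterval_iff {ℓ : ℕ} {i : Fin (2 ^ ℓ)} {x : unitInterval} :
    x ∈ dyadicInterval ℓ i ↔ quant ℓ x = i := by
  have hp : (0 : ℝ) < 2 ^ ℓ := by positivity
  have hx0 : 0 ≤ (x : ℝ) * 2 ^ ℓ := mul_nonneg x.2.1 hp.le
  have hx1 : (x : ℝ) * 2 ^ ℓ ≤ 2 ^ ℓ := mul_le_of_le_one_left hp.le x.2.2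
  have hfl : ⌊(x : ℝ) * 2 ^ ℓ⌋₊ ≤ 2 ^ ℓ := by
    have h := Nat.floor_le_floor hx1
    have h' : ⌊(2 : ℝ) ^ ℓ⌋₊ = 2 ^ ℓ := by exact_mod_cast Nat.floor_natCast (R := ℝ) (2 ^ ℓ)
    omega
  have hi := i.2
  unfold dyadicInterval quant
  rw [Set.mem_ofPred_eq, div_le_iff₀ hp, lt_div_iff₀ hp, Fin.ext_iff]
  simp only
  have h1 : ((i : ℕ) : ℝ) ≤ (x : ℝ) * 2 ^ ℓ ↔ (i : ℕ) ≤ ⌊(x : ℝ) * 2 ^ ℓ⌋₊ :=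
    (Nat.le_floor_iff hx0).symm
  have h2 : (x : ℝ) * 2 ^ ℓ < (i : ℕ) + 1 ↔ ⌊(x : ℝ) * 2 ^ ℓ⌋₊ < (i : ℕ) + 1 := by
    rw [Nat.floor_lt hx0]; push_cast; rfl
  rw [h1, h2]
  omega

theorem mem_dyadicCube_iff {k ℓ : ℕ} {c : Fin k → Fin (2 ^ ℓ)} {x : Fin k → unitInterval} :
    x ∈ dyadicCube ℓ c ↔ (fun r => quant ℓ (x r)) = c := by
  simp only [dyadicCube, Set.mem_ofPred_eq, mem_dyadicInterval_iff, funext_iff]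

theorem measurable_quant (ℓ : ℕ) : Measurable (quant ℓ) := by
  refine measurable_to_countable' fun i => ?_
  have : quant ℓ ⁻¹' {i} = dyadicInterval ℓ i := by
    ext x; rw [mem_dyadicInterval_iff]; rfl
  rw [this]
  exact (measurableSet_le measurable_const measurable_subtype_coe).inter
    ((measurableSet_lt measurable_subtype_coe measurable_const).union (MeasurableSet.const _))

theorem measurableSet_dyadicCube {k ℓ : ℕ} (c : Fin k → Fin (2 ^ ℓ)) :
    MeasurableSet (dyadicCube ℓ c) := by
  have : dyadicCube ℓ c = ⋂ r, (fun x : Fin k → unitInterval => quant ℓ (x r)) ⁻¹' {c r} := by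
    ext x
    simp [mem_dyadicCube_iff, funext_iff]
  rw [this]
  exact MeasurableSet.iInter fun r =>
    ((measurable_quant ℓ).comp (measurable_pi_apply r)) (measurableSet_singleton _)

/-- Dyadic partitions are nested: floors are compatible with integer division, and so is the
truncation, because division is monotone and sends the last fine index to the last coarse one. -/
theorem quant_eq_div {ℓ ℓ' : ℕ} (h : ℓ ≤ ℓ') (x : unitInterval) :
    (quant ℓ x : ℕ) = (quant ℓ' x : ℕ) / 2 ^ (ℓ' - ℓ) := by
  obtain ⟨d, rfl⟩ := Nat.exists_eq_add_of_le h
  have hd : 0 < 2 ^ d := by positivity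
  have hl : 0 < 2 ^ ℓ := by positivity
  have h1 : ⌊(x : ℝ) * 2 ^ ℓ⌋₊ = ⌊(x : ℝ) * 2 ^ (ℓ + d)⌋₊ / 2 ^ d := by
    rw [← Nat.floor_div_natCast, pow_add]
    congr 1
    push_cast
    field_simp
  have h2 : (2 ^ (ℓ + d) - 1) / 2 ^ d = 2 ^ ℓ - 1 := by
    rw [Nat.div_eq_iff hd, pow_add, Nat.sub_mul]
    have : 2 ^ d ≤ 2 ^ ℓ * 2 ^ d := Nat.le_mul_of_pos_left _ hl
    omega
  simp only [quant, Nat.add_sub_cancel_left]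
  rw [h1, ← h2]
  have hmono : Monotone fun a : ℕ => a / 2 ^ d := fun a b h => Nat.div_le_div_right h
  exact hmono.map_min.symm

theorem tendsto_quant_div (x : unitInterval) :
    Tendsto (fun ℓ => ((quant ℓ x : ℕ) : ℝ) / 2 ^ ℓ) atTop (𝓝 (x : ℝ)) := by
  have h0 : Tendsto (fun ℓ : ℕ => (x : ℝ) - (1 / 2) ^ ℓ) atTop (𝓝 (x : ℝ)) := by
    simpa using tendsto_const_nhds.sub
      (tendsto_pow_atTop_nhds_zero_of_lt_one (r := (1 / 2 : ℝ)) (by norm_num) (by norm_num))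
  refine tendsto_of_tendsto_of_tendsto_of_le_of_le h0 tendsto_const_nhds ?_ ?_
  · intro ℓ
    have hp : (0 : ℝ) < 2 ^ ℓ := by positivity
    have hx := (mem_dyadicInterval_iff (ℓ := ℓ) (x := x)).2 rfl
    have : (x : ℝ) ≤ ((quant ℓ x : ℕ) + 1) / 2 ^ ℓ := by
      rcases hx.2 with h | h
      · exact h.le
      · have : ((quant ℓ x : ℕ) : ℝ) + 1 = 2 ^ ℓ := by exact_mod_cast h
        rw [this, div_self hp.ne']
        exact x.2.2
    rw [add_div] at this
    simp only [one_div, inv_pow] at this ⊢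
    linarith
  · intro ℓ
    exact ((mem_dyadicInterval_iff (ℓ := ℓ) (x := x)).2 rfl).1

/-! ### Blocks of the process -/

theorem measurable_X_sigmaX {T : Set ℕ} {t : ℕ} (ht : t ∈ T) : Measurable[sigmaX T] (X t) :=
  measurable_iff_comap_le.2 (le_iSup₂_of_le t ht le_rfl)

theorem measurable_block_sigmaX {T : Set ℕ} {a k : ℕ} (h : ∀ r < k, a + r ∈ T) :
    Measurable[sigmaX T] (block a k) :=
  @measurable_pi_lambda _ _ _ (sigmaX T) _ _ fun r => measurable_X_sigmaX (h r r.2)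

theorem measurable_block (a k : ℕ) : Measurable (block a k) :=
  measurable_pi_lambda _ fun _ => measurable_X _

/-- The indices of the dyadic intervals containing the entries of `block a k ω`. -/
def quantBlock (ℓ a k : ℕ) (ω : Path) : Fin k → Fin (2 ^ ℓ) := fun r => quant ℓ (X (a + r) ω)

theorem quantBlock_eq_iff {ℓ a k : ℕ} {ω : Path} {c : Fin k → Fin (2 ^ ℓ)} :
    quantBlock ℓ a k ω = c ↔ block a k ω ∈ dyadicCube ℓ c :=
  mem_dyadicCube_iff.symm

theorem measurableSet_quantBlock {T : Set ℕ} {a k : ℕ} (h : ∀ r < k, a + r ∈ T) (ℓ : ℕ)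
    (c : Fin k → Fin (2 ^ ℓ)) : MeasurableSet[sigmaX T] {ω | quantBlock ℓ a k ω = c} := by
  simp only [quantBlock_eq_iff]
  exact measurable_block_sigmaX h (measurableSet_dyadicCube c)

theorem exists_quantBlock_factor {ℓ ℓ' k k' : ℕ} (hℓ : ℓ ≤ ℓ') (hk : k ≤ k') (a : ℕ) :
    ∃ φ : (Fin k' → Fin (2 ^ ℓ')) → Fin k → Fin (2 ^ ℓ),
      ∀ ω, quantBlock ℓ a k ω = φ (quantBlock ℓ' a k' ω) := by
  refine ⟨fun c r => ⟨(c (Fin.castLE hk r) : ℕ) / 2 ^ (ℓ' - ℓ), ?_⟩, ?_⟩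
  · rw [Nat.div_lt_iff_lt_mul (by positivity), ← pow_add, Nat.add_sub_cancel' hℓ]
    exact (c _).2
  · intro ω
    funext r
    exact Fin.ext (quant_eq_div hℓ _)

/-! ### The β-mixing coefficients along dyadic partitions -/

/-- The β-dependence of the dyadic quantizations of `X₁, …, X_j` and `X_{j+m}, …, X_n`,
maximized over `j ∈ {1, …, n - m}`. -/
def betaCell (μ : Measure Path) (ℓ n m : ℕ) : ℝ :=
  ⨆ j : {j : ℕ // j ∈ Finset.Icc 1 (n - m)},
    (1 / 2 : ℝ) * ∑ q, |jointDev μ (quantBlock ℓ 1 j.1)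
      (quantBlock ℓ (j.1 + m) (n - m - j.1 + 1)) q|

theorem betaMixing_nonneg (μ : Measure Path) (m : ℕ) : 0 ≤ betaMixing μ m :=
  Real.iSup_nonneg fun _ => betaDep_nonneg μ _ _

theorem betaCell_nonneg (μ : Measure Path) (ℓ n m : ℕ) : 0 ≤ betaCell μ ℓ n m :=
  Real.iSup_nonneg fun _ => by positivity

section Limit

variable (μ : Measure Path) [IsProbabilityMeasure μ]

theorem betaDep_le_betaMixing {j : ℕ} (hj : 1 ≤ j) (m : ℕ) :
    betaDep μ (sigmaX_le (Set.Icc 1 j)) (sigmaX_le (Set.Ici (j + m))) ≤ betaMixing μ m :=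
  le_ciSup (f := fun j : {j : ℕ // 1 ≤ j} =>
    betaDep μ (sigmaX_le (Set.Icc 1 j.1)) (sigmaX_le (Set.Ici (j.1 + m))))
    ⟨1, by rintro _ ⟨j, rfl⟩; exact betaDep_le_one μ _ _⟩ ⟨j, hj⟩

/-- The quantized blocks are measurable for the past up to `j` and the future from `j + m`;
discretizing and cutting off at `n` only lose dependence. -/
theorem betaCell_le_betaMixing (ℓ n m : ℕ) : betaCell μ ℓ n m ≤ betaMixing μ m := by
  refine Real.iSup_le (fun j => ?_) (betaMixing_nonneg μ m)
  have hj := Finset.mem_Icc.1 j.2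
  refine le_trans ?_ (betaDep_le_betaMixing μ hj.1 m)
  exact half_sum_jointDev_le_betaDep μ _ _
    (measurableSet_quantBlock (fun r hr => Set.mem_Icc.2 ⟨by omega, by omega⟩) ℓ)
    (measurableSet_quantBlock (fun r hr => Set.mem_Ici.2 (by omega)) ℓ)

/-- The σ-algebra on `Path × Path` of the pair of quantized blocks. -/
@[reducible] def quantPairSigma (j m N : ℕ) : MeasurableSpace (Path × Path) :=
  MeasurableSpace.comap (fun p => (quantBlock N 1 j p.1, quantBlock N (j + m) N p.2)) ⊤

/-- A set decided at stage `N` is still a union of cells at any finer resolution and longer second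
block, because the coarse indices are functions of the fine ones. -/
theorem exists_factor_quantPairSigma {j m N ℓ k : ℕ} (hℓ : N ≤ ℓ) (hk : N ≤ k)
    {W : Set (Path × Path)} (hW : MeasurableSet[quantPairSigma j m N] W) :
    ∃ S : Set ((Fin j → Fin (2 ^ ℓ)) × (Fin k → Fin (2 ^ ℓ))),
      W = {p | (quantBlock ℓ 1 j p.1, quantBlock ℓ (j + m) k p.2) ∈ S} := by
  obtain ⟨S, -, rfl⟩ := hW
  obtain ⟨φ, hφ⟩ := exists_quantBlock_factor hℓ (le_refl j) 1
  obtain ⟨ψ, hψ⟩ := exists_quantBlock_factor hℓ hk (j + m)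
  refine ⟨{q | (φ q.1, ψ q.2) ∈ S}, ?_⟩
  ext p
  simp only [Set.mem_preimage, Set.mem_ofPred_eq, hφ, hψ]

theorem monotone_quantPairSigma (j m : ℕ) : Monotone (quantPairSigma j m) := by
  intro N N' h W hW
  obtain ⟨S, rfl⟩ := exists_factor_quantPairSigma h h hW
  exact ⟨S, trivial, rfl⟩

/-- A function is the pointwise limit of its quantizations. Only large `ℓ` are required because a
given future coordinate enters the second block of `quantPairSigma` only once that block is long
enough. -/
theorem measurable_of_measurable_quant {α : Type*} {mα : MeasurableSpace α}
    {f : α → unitInterval} (h : ∀ᶠ ℓ in atTop, Measurable fun a => quant ℓ (f a)) :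
    Measurable f := by
  obtain ⟨L, hL⟩ := eventually_atTop.1 h
  suffices h' : Measurable fun a => (f a : ℝ) from h'.subtype_mk (h := fun a => (f a).2)
  refine measurable_of_tendsto_metrizable
    (f := fun ℓ a => ((quant (ℓ + L) (f a) : ℕ) : ℝ) / 2 ^ (ℓ + L)) (fun ℓ => ?_) ?_
  · exact (measurable_from_top (f := fun i : Fin (2 ^ (ℓ + L)) => ((i : ℕ) : ℝ) / 2 ^ (ℓ + L))).comp
      (hL (ℓ + L) (Nat.le_add_left _ _))
  · exact tendsto_pi_nhds.2 fun a =>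
      (tendsto_quant_div (f a)).comp (tendsto_add_atTop_nat L)

theorem prod_sigmaX_eq_iSup (j m : ℕ) :
    MeasurableSpace.prod (sigmaX (Set.Icc 1 j)) (sigmaX (Set.Ici (j + m)))
      = ⨆ N, quantPairSigma j m N := by
  apply le_antisymm
  · have hpair : ∀ N, Measurable[⨆ N, quantPairSigma j m N, ⊤]
        fun p : Path × Path => (quantBlock N 1 j p.1, quantBlock N (j + m) N p.2) := fun N =>
      measurable_iff_comap_le.2 (le_iSup (quantPairSigma j m) N)
    refine sup_le ?_ ?_
    · rw [MeasurableSpace.comap_le_iff_le_map]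
      refine iSup₂_le fun t ht => ?_
      rw [MeasurableSpace.comap_le_iff_le_map]
      refine @measurable_of_measurable_quant _ (⨆ N, quantPairSigma j m N)
        (fun p : Path × Path => X t p.1) (Eventually.of_forall fun ℓ => ?_)
      have ht' := Set.mem_Icc.1 ht
      have := (measurable_from_top (f := fun q : (Fin j → Fin (2 ^ ℓ)) × (Fin ℓ → Fin (2 ^ ℓ)) =>
        q.1 ⟨t - 1, by omega⟩)).comp (hpair ℓ)
      convert this using 2 with p
      simp only [Function.comp, quantBlock]
      rw [Nat.add_sub_cancel' ht'.1]
    · rw [MeasurableSpace.comap_le_iff_le_map]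
      refine iSup₂_le fun t ht => ?_
      rw [MeasurableSpace.comap_le_iff_le_map]
      have ht' := Set.mem_Ici.1 ht
      refine @measurable_of_measurable_quant _ (⨆ N, quantPairSigma j m N)
        (fun p : Path × Path => X t p.2)
        (eventually_atTop.2 ⟨t - (j + m) + 1, fun ℓ hℓ => ?_⟩)
      have := (measurable_from_top (f := fun q : (Fin j → Fin (2 ^ ℓ)) × (Fin ℓ → Fin (2 ^ ℓ)) =>
        q.2 ⟨t - (j + m), by omega⟩)).comp (hpair ℓ)
      convert this using 2 with p
      simp only [Function.comp, quantBlock]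
      rw [Nat.add_sub_cancel' ht']
  · refine iSup_le fun N => ?_
    rintro _ ⟨S, -, rfl⟩
    classical
    have := measurableSet_preimage_prod
      (measurableSet_quantBlock (T := Set.Icc 1 j) (a := 1) (k := j)
        (fun r hr => Set.mem_Icc.2 ⟨by omega, by omega⟩) N)
      (measurableSet_quantBlock (T := Set.Ici (j + m)) (a := j + m) (k := N)
        (fun r hr => Set.mem_Ici.2 (by omega)) N) S.toFinset
    simp only [Set.mem_toFinset] at this
    exact this

theorem eventually_lt_betaCell {m : ℕ} {c : ℝ} (hc : c < betaMixing μ m) :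
    ∃ N, ∀ ℓ n, N ≤ ℓ → N ≤ n → c < betaCell μ ℓ n m := by
  have hne : Nonempty {j : ℕ // 1 ≤ j} := ⟨⟨1, le_rfl⟩⟩
  obtain ⟨⟨j, hj⟩, hcj⟩ := exists_lt_of_lt_ciSup hc
  have hne' : Nonempty {W : Set (Path × Path) // MeasurableSet[MeasurableSpace.prod
      (sigmaX (Set.Icc 1 j)) (sigmaX (Set.Ici (j + m)))] W} :=
    ⟨⟨∅, @MeasurableSet.empty _ (MeasurableSpace.prod _ _)⟩⟩
  obtain ⟨⟨W, hW⟩, hcW⟩ := exists_lt_of_lt_ciSup hcj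
  have hU := sigmaX_le (Set.Icc 1 j)
  have hV := sigmaX_le (Set.Ici (j + m))
  have i1 := isProbabilityMeasure_diagMeasure μ hU hV
  have i2 := isProbabilityMeasure_restrProd μ hU hV
  -- With half the gap as tolerance in each of the two measures, the difference on `W'` still
  -- exceeds `c` in absolute value.
  obtain ⟨N, W', hW', h1, h2⟩ := @exists_abs_measureReal_sub_lt (Path × Path)
    (MeasurableSpace.prod (sigmaX (Set.Icc 1 j)) (sigmaX (Set.Ici (j + m))))
    (diagMeasure μ _ _) (restrProd μ hU hV) inferInstance inferInstance _
    (monotone_quantPairSigma j m) (prod_sigmaX_eq_iSup j m) W hW _ (half_pos (sub_pos.2 hcW))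
  -- This threshold makes `j` an admissible split point and gives the second block, of length `n - m
  -- - j + 1`, at least `N` entries.
  refine ⟨N + m + j, fun ℓ n hℓ hn => ?_⟩
  have hjn : j ∈ Finset.Icc 1 (n - m) := Finset.mem_Icc.2 ⟨hj, by omega⟩
  obtain ⟨S, hS⟩ := exists_factor_quantPairSigma (ℓ := ℓ) (k := n - m - j + 1)
    (by omega) (by omega) hW'
  have h3 := abs_diag_sub_restrProd_le_half_sum_jointDev μ hU hV
    (measurableSet_quantBlock (T := Set.Icc 1 j) (a := 1) (k := j)
        (fun r hr => Set.mem_Icc.2 ⟨by omega, by omega⟩) ℓ)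
    (measurableSet_quantBlock (T := Set.Ici (j + m)) (a := j + m) (k := n - m - j + 1)
        (fun r hr => Set.mem_Ici.2 (by omega)) ℓ) S
  rw [← hS] at h3
  have h4 : (1 / 2 : ℝ) * ∑ q, |jointDev μ (quantBlock ℓ 1 j)
      (quantBlock ℓ (j + m) (n - m - j + 1)) q| ≤ betaCell μ ℓ n m :=
    le_ciSup (f := fun j : {j : ℕ // j ∈ Finset.Icc 1 (n - m)} =>
      (1 / 2 : ℝ) * ∑ q, |jointDev μ (quantBlock ℓ 1 j.1)
        (quantBlock ℓ (j.1 + m) (n - m - j.1 + 1)) q|) (Set.finite_range _).bddAbove ⟨j, hjn⟩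
  unfold Measure.real at h1 h2
  simp only [abs_lt] at h1 h2
  rcases abs_cases ((diagMeasure μ (sigmaX (Set.Icc 1 j)) (sigmaX (Set.Ici (j + m))) W).toReal
    - (restrProd μ hU hV W).toReal) with h5 | h5 <;>
  have h6 := abs_le.1 (h3.trans h4) <;> linarith

theorem tendsto_betaCell {ℓ n : ℕ → ℕ} (hℓ : Tendsto ℓ atTop atTop)
    (hn : Tendsto n atTop atTop) (m : ℕ) :
    Tendsto (fun t => betaCell μ (ℓ t) (n t) m) atTop (𝓝 (betaMixing μ m)) := by
  refine tendsto_order.2 ⟨fun c hc => ?_, fun c hc =>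
    Eventually.of_forall fun t => (betaCell_le_betaMixing μ _ _ m).trans_lt hc⟩
  obtain ⟨N, hN⟩ := eventually_lt_betaCell μ hc
  filter_upwards [hℓ.eventually_ge_atTop N, hn.eventually_ge_atTop N] with t h1 h2
  exact hN _ _ h1 h2

end Limit

/-! ### Concentration of empirical measures -/

theorem sum_comp_le_tsum_of_injOn {ι : Type*} {g : ℕ → ℝ} (hg : Summable g) (h0 : ∀ m, 0 ≤ g m)
    {s : Finset ι} {φ : ι → ℕ} (hφ : Set.InjOn φ s) : ∑ i ∈ s, g (φ i) ≤ ∑' m, g m := by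
  classical
  rw [← Finset.sum_image hφ]
  exact hg.sum_le_tsum _ fun m _ => h0 m

/-- The bound on `t` times the variance of an empirical measure of `t` blocks. -/
def mixingConst (μ : Measure Path) : ℝ := 1 + 2 * ∑' m, betaMixing μ (m + 1)

theorem mixingConst_nonneg (μ : Measure Path) : 0 ≤ mixingConst μ := by
  have : 0 ≤ ∑' m, betaMixing μ (m + 1) := tsum_nonneg fun m => betaMixing_nonneg μ _
  unfold mixingConst
  positivity

/-- The indicator of the event that the `i`-th block of length `n` lies in `D`. -/
def blockIndicator {n : ℕ} (D : Set (Fin n → unitInterval)) (i : ℕ) (ω : Path) : ℝ :=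
  D.indicator (fun _ => (1 : ℝ)) (block (i * n + 1) n ω)

section Chebyshev

variable {n : ℕ} {D : Set (Fin n → unitInterval)}

theorem blockIndicator_eq (D : Set (Fin n → unitInterval)) (i : ℕ) :
    blockIndicator D i = (block (i * n + 1) n ⁻¹' D).indicator 1 := rfl

theorem memLp_blockIndicator (μ : Measure Path) [IsProbabilityMeasure μ] (hD : MeasurableSet D)
    (i : ℕ) : MemLp (blockIndicator D i) 2 μ := by
  rw [blockIndicator_eq]
  exact (memLp_const (1 : ℝ)).indicator (measurable_block _ _ hD)

theorem measureReal_block_mem {μ : Measure Path} (hstat : IsStationary μ)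
    (hD : MeasurableSet D) (a : ℕ) :
    μ.real {ω | block (a + 1) n ω ∈ D} = μ.real {ω | block 1 n ω ∈ D} := by
  have := hstat a n D hD
  unfold Measure.real block
  rw [this, Nat.add_comm a 1]

theorem integral_blockIndicator {μ : Measure Path} (hstat : IsStationary μ)
    (hD : MeasurableSet D) (i : ℕ) :
    ∫ ω, blockIndicator D i ω ∂μ = μ.real {ω | block 1 n ω ∈ D} := by
  rw [blockIndicator_eq, integral_indicator_one (measurable_block _ _ hD)]
  exact measureReal_block_mem hstat hD _

/-- Block `i` ends at time `(i + 1) * n` and block `i'` starts at `i' * n + 1`, which leaves a lag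
of `(i' - i - 1) * n + 1`. -/
theorem covariance_blockIndicator_le {μ : Measure Path} [IsProbabilityMeasure μ]
    (hD : MeasurableSet D) {i i' : ℕ} (h : i < i') (hn : 1 ≤ n) :
    ProbabilityTheory.covariance (blockIndicator D i) (blockIndicator D i') μ
      ≤ betaMixing μ ((i' - i - 1) * n + 1) := by
  have hmul : blockIndicator D i * blockIndicator D i'
      = (block (i * n + 1) n ⁻¹' D ∩ block (i' * n + 1) n ⁻¹' D).indicator 1 := by
    rw [blockIndicator_eq, blockIndicator_eq, Set.inter_indicator_one]
  have hm : ∀ i, MeasurableSet (block (i * n + 1) n ⁻¹' D) := fun i => measurable_block _ _ hD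
  rw [ProbabilityTheory.covariance_eq_sub (memLp_blockIndicator μ hD i)
    (memLp_blockIndicator μ hD i'), hmul, blockIndicator_eq, blockIndicator_eq,
    integral_indicator_one (hm i), integral_indicator_one (hm i'),
    integral_indicator_one ((hm i).inter (hm i'))]
  have hi : i' * n + 1 = (i + 1) * n + ((i' - i - 1) * n + 1) := by
    obtain ⟨d, rfl⟩ := Nat.exists_eq_add_of_lt h
    rw [show i + d + 1 - i - 1 = d by omega]
    ring
  have hj : 1 ≤ (i + 1) * n := Nat.mul_pos (Nat.succ_pos i) hn
  refine (le_abs_self _).trans ((abs_measureReal_inter_sub_le_betaDep μ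
    (sigmaX_le (Set.Icc 1 ((i + 1) * n)))
    (sigmaX_le (Set.Ici ((i + 1) * n + ((i' - i - 1) * n + 1)))) ?_ ?_).trans
    (betaDep_le_betaMixing μ hj _))
  · refine measurable_block_sigmaX (fun r hr => Set.mem_Icc.2 ⟨by omega, ?_⟩) hD
    rw [Nat.add_mul]
    omega
  · exact measurable_block_sigmaX (fun r hr => Set.mem_Ici.2 (by omega)) hD

theorem variance_blockIndicator_le {μ : Measure Path} [IsProbabilityMeasure μ]
    (hD : MeasurableSet D) (i : ℕ) :
    ProbabilityTheory.variance (blockIndicator D i) μ ≤ 1 := by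
  have hm : MeasurableSet (block (i * n + 1) n ⁻¹' D) := measurable_block _ _ hD
  refine (ProbabilityTheory.variance_le_expectation_sq
    (memLp_blockIndicator μ hD i).aestronglyMeasurable).trans ?_
  have : blockIndicator D i ^ 2 = (block (i * n + 1) n ⁻¹' D).indicator 1 := by
    funext ω
    by_cases h : ω ∈ block (i * n + 1) n ⁻¹' D <;> simp [blockIndicator_eq, h]
  rw [this, integral_indicator_one hm]
  exact measureReal_le_one

/-- Each row of the covariance matrix is bounded by `mixingConst`: at most `1` on the diagonal and
one full series of mixing coefficients on either side. -/
theorem variance_sum_blockIndicator_le {μ : Measure Path} [IsProbabilityMeasure μ]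
    (hsum : Summable fun m => betaMixing μ (m + 1)) (hD : MeasurableSet D) (hn : 1 ≤ n) (t : ℕ) :
    ProbabilityTheory.variance (fun ω => ∑ i ∈ Finset.range t, blockIndicator D i ω) μ
      ≤ t * mixingConst μ := by
  rw [ProbabilityTheory.variance_fun_sum' fun i _ => memLp_blockIndicator μ hD i]
  set g : ℕ → ℝ := fun m => betaMixing μ (m + 1) with hg
  have hg0 : ∀ m, 0 ≤ g m := fun m => betaMixing_nonneg μ _
  have hrow : ∀ i ∈ Finset.range t, ∑ i' ∈ Finset.range t,
      ProbabilityTheory.covariance (blockIndicator D i) (blockIndicator D i') μ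
        ≤ mixingConst μ := by
    intro i hi
    have hle : ∀ i' ∈ Finset.range t,
        ProbabilityTheory.covariance (blockIndicator D i) (blockIndicator D i') μ
        ≤ (if i = i' then 1 else 0) + (if i < i' then g ((i' - i - 1) * n) else 0)
          + (if i' < i then g ((i - i' - 1) * n) else 0) := by
      intro i' _
      rcases lt_trichotomy i i' with h | h | h
      · simpa [h, h.ne, h.not_gt] using covariance_blockIndicator_le hD h hn
      · subst h
        simpa [ProbabilityTheory.covariance_self
          (memLp_blockIndicator μ hD i).aestronglyMeasurable.aemeasurable]
          using variance_blockIndicator_le hD i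
      · rw [ProbabilityTheory.covariance_comm]
        simpa [h, h.ne', h.not_gt] using covariance_blockIndicator_le hD h hn
    refine (Finset.sum_le_sum hle).trans ?_
    rw [Finset.sum_add_distrib, Finset.sum_add_distrib, Finset.sum_ite_eq, if_pos hi,
      ← Finset.sum_filter, ← Finset.sum_filter]
    -- Since `n ≥ 1`, distinct blocks give distinct lags, so the sum is a partial sum of the series;
    -- monotonicity of `β` is not needed.
    have h1 : ∑ i' ∈ Finset.range t with i < i', g ((i' - i - 1) * n) ≤ ∑' m, g m := by
      refine sum_comp_le_tsum_of_injOn hsum hg0 ?_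
      intro x hx y hy hxy
      have hx' := (Finset.mem_filter.1 hx).2
      have hy' := (Finset.mem_filter.1 hy).2
      have := Nat.eq_of_mul_eq_mul_right hn hxy
      omega
    have h2 : ∑ i' ∈ Finset.range t with i' < i, g ((i - i' - 1) * n) ≤ ∑' m, g m := by
      refine sum_comp_le_tsum_of_injOn hsum hg0 ?_
      intro x hx y hy hxy
      have hx' := (Finset.mem_filter.1 hx).2
      have hy' := (Finset.mem_filter.1 hy).2
      have := Nat.eq_of_mul_eq_mul_right hn hxy
      omega
    unfold mixingConst
    linarith
  refine (Finset.sum_le_sum hrow).trans ?_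
  simp

theorem empMeasure_eq (t : ℕ) (ω : Path) (D : Set (Fin n → unitInterval)) :
    empMeasure t ω D = (1 / (t : ℝ)) * ∑ i ∈ Finset.range t, blockIndicator D i ω := rfl

theorem empMeasure_mem_Icc (t : ℕ) (ω : Path) (D : Set (Fin n → unitInterval)) :
    empMeasure t ω D ∈ Set.Icc (0 : ℝ) 1 := by
  have h0 : ∀ i, 0 ≤ blockIndicator D i ω := fun i => Set.indicator_nonneg (by simp) _
  have h1 : ∀ i, blockIndicator D i ω ≤ 1 := fun i =>
    Set.indicator_le_self' (f := fun _ => (1 : ℝ)) (by simp) _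
  rw [empMeasure_eq]
  refine ⟨mul_nonneg (by positivity) (Finset.sum_nonneg fun i _ => h0 i), ?_⟩
  have : ∑ i ∈ Finset.range t, blockIndicator D i ω ≤ t := by
    simpa using Finset.sum_le_sum fun i (_ : i ∈ Finset.range t) => h1 i
  rw [one_div, inv_mul_eq_div]
  exact div_le_one_of_le₀ this (Nat.cast_nonneg t)

theorem measure_empMeasure_deviation_le {μ : Measure Path} [IsProbabilityMeasure μ]
    (hstat : IsStationary μ) (hsum : Summable fun m => betaMixing μ (m + 1))
    (hD : MeasurableSet D) (hn : 1 ≤ n) {t : ℕ} (ht : 0 < t) {η : ℝ} (hη : 0 < η) :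
    μ {ω | η ≤ |empMeasure t ω D - μ.real {ω | block 1 n ω ∈ D}|}
      ≤ ENNReal.ofReal (mixingConst μ / (t * η ^ 2)) := by
  have ht' : (0 : ℝ) < t := Nat.cast_pos.2 ht
  have hL : MemLp (fun ω => empMeasure t ω D) 2 μ := by
    simp only [empMeasure_eq]
    exact (memLp_finsetSum _ fun i _ => memLp_blockIndicator μ hD i).const_mul _
  have hE : ∫ ω, empMeasure t ω D ∂μ = μ.real {ω | block 1 n ω ∈ D} := by
    simp only [empMeasure_eq]
    rw [integral_const_mul, integral_finsetSum _ fun i _ =>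
      (memLp_blockIndicator μ hD i).integrable (by norm_num)]
    simp only [integral_blockIndicator hstat hD, Finset.sum_const, Finset.card_range, nsmul_eq_mul]
    field_simp
  have hV : ProbabilityTheory.variance (fun ω => empMeasure t ω D) μ ≤ mixingConst μ / t := by
    simp only [empMeasure_eq]
    rw [ProbabilityTheory.variance_const_mul]
    refine (mul_le_mul_of_nonneg_left (variance_sum_blockIndicator_le hsum hD hn t)
      (by positivity)).trans_eq ?_
    field_simp
  have := ProbabilityTheory.meas_ge_le_variance_div_sq hL hη
  rw [hE] at this
  refine this.trans (ENNReal.ofReal_le_ofReal ?_)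
  rw [← div_div]
  gcongr

end Chebyshev

/-! ### Deviation of the estimator from its deterministic counterpart -/

/-- The vectors of length `n` whose first `j` entries lie in `A`, and whose `j'` entries from
position `j + m` on lie in `B`. -/
def jointSet {n m j j' : ℕ} (h : j + m - 1 + j' ≤ n) (hj : j ≤ n)
    (A : Set (Fin j → unitInterval)) (B : Set (Fin j' → unitInterval)) :
    Set (Fin n → unitInterval) :=
  {x | (fun r : Fin j => x (Fin.castLE hj r)) ∈ A ∧
    (fun r : Fin j' => x ⟨j + m - 1 + r, by omega⟩) ∈ B}

section Joint

variable {n m j j' : ℕ} (h : j + m - 1 + j' ≤ n) (hj : j ≤ n)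
  {A : Set (Fin j → unitInterval)} {B : Set (Fin j' → unitInterval)}

theorem measurableSet_jointSet (hA : MeasurableSet A) (hB : MeasurableSet B) :
    MeasurableSet (jointSet h hj A B) :=
  MeasurableSet.inter
    ((measurable_pi_lambda _ fun _ => measurable_pi_apply _ :
      Measurable fun x : Fin n → unitInterval => fun r : Fin j => x (Fin.castLE hj r)) hA)
    ((measurable_pi_lambda _ fun _ => measurable_pi_apply _ :
      Measurable fun x : Fin n → unitInterval => fun r : Fin j' =>
        x ⟨j + m - 1 + r, by omega⟩) hB)

theorem block_mem_jointSet_iff (hjm : 1 ≤ j + m) (a : ℕ) (ω : Path) :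
    block (a + 1) n ω ∈ jointSet h hj A B ↔ block (a + 1) j ω ∈ A ∧ block (a + j + m) j' ω ∈ B := by
  have h1 : (fun r : Fin j => block (a + 1) n ω (Fin.castLE hj r)) = block (a + 1) j ω := rfl
  have h2 : (fun r : Fin j' => block (a + 1) n ω ⟨j + m - 1 + r, by omega⟩)
      = block (a + j + m) j' ω := by
    funext r
    unfold block
    congr 1
    simp only
    omega
  unfold jointSet
  rw [Set.mem_ofPred_eq, h1, h2]

/-- A joint frequency is the empirical measure of a single set of vectors of length `n`, so the same
Chebyshev bound covers it. -/
theorem empJoint_eq_empMeasure (hjm : 1 ≤ j + m) (t : ℕ) (ω : Path) :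
    empJoint t n m ω A B = empMeasure t ω (jointSet h hj A B) := by
  classical
  unfold empJoint empMeasure
  congr 1
  refine Finset.sum_congr rfl fun i _ => ?_
  simp only [Set.indicator_apply, block_mem_jointSet_iff h hj hjm]
  split_ifs <;> simp_all

theorem measureReal_block_mem_jointSet (hjm : 1 ≤ j + m) (μ : Measure Path) :
    μ.real {ω | block 1 n ω ∈ jointSet h hj A B}
      = μ.real {ω | block 1 j ω ∈ A ∧ block (j + m) j' ω ∈ B} := by
  have := block_mem_jointSet_iff (A := A) (B := B) h hj hjm 0
  simp only [Nat.zero_add] at this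
  simp only [this]

end Joint

theorem abs_mul_sub_mul_le {x y p q η : ℝ} (hx : x ∈ Set.Icc (0 : ℝ) 1) (hq : q ∈ Set.Icc (0 : ℝ) 1)
    (h1 : |x - p| ≤ η) (h2 : |y - q| ≤ η) : |x * y - p * q| ≤ 2 * η := by
  have e : x * y - p * q = x * (y - q) + (x - p) * q := by ring
  rw [e]
  refine (abs_add_le _ _).trans ?_
  rw [abs_mul, abs_mul, abs_of_nonneg hx.1, abs_of_nonneg hq.1]
  have h3 := mul_le_mul hx.2 h2 (abs_nonneg _) zero_le_one
  have h4 := mul_le_mul h1 hq.2 hq.1 ((abs_nonneg _).trans h1)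
  linarith

/-- The assumption `0 ≤ c` covers the empty index type, where both suprema are `0`; this occurs when
`n ≤ m`. -/
theorem abs_iSup_sub_iSup_le {ι : Type*} [Finite ι] {f g : ι → ℝ} {c : ℝ} (hc : 0 ≤ c)
    (h : ∀ i, |f i - g i| ≤ c) : |(⨆ i, f i) - ⨆ i, g i| ≤ c := by
  rcases isEmpty_or_nonempty ι with hι | hι
  · simpa using hc
  · have key : ∀ f g : ι → ℝ, (∀ i, |f i - g i| ≤ c) → (⨆ i, f i) ≤ (⨆ i, g i) + c := by
      intro f g h
      refine ciSup_le fun i => ?_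
      have h1 := le_ciSup (Set.finite_range g).bddAbove i
      have h2 := (abs_le.1 (h i)).2
      linarith
    have h1 := key f g h
    have h2 := key g f fun i => by rw [abs_sub_comm]; exact h i
    exact abs_le.2 ⟨by linarith, by linarith⟩

section Deviation

variable {μ : Measure Path} [IsProbabilityMeasure μ]

/-- The paths along which some empirical frequency entering `betaHat` at lag index `j` deviates by
at least `η` from the corresponding probability. -/
def deviationSet (μ : Measure Path) (t n ℓ m j : ℕ) (η : ℝ) : Set Path :=
  ⋃ q : (Fin j → Fin (2 ^ ℓ)) × (Fin (n - m - j + 1) → Fin (2 ^ ℓ)),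
    {ω | η ≤ |empJoint t n m ω (dyadicCube ℓ q.1) (dyadicCube ℓ q.2)
        - μ.real {ω | block 1 j ω ∈ dyadicCube ℓ q.1 ∧
            block (j + m) (n - m - j + 1) ω ∈ dyadicCube ℓ q.2}|}
    ∪ {ω | η ≤ |empMeasure t ω (dyadicCube ℓ q.1)
        - μ.real {ω | block 1 j ω ∈ dyadicCube ℓ q.1}|}
    ∪ {ω | η ≤ |empMeasure t ω (dyadicCube ℓ q.2)
        - μ.real {ω | block 1 (n - m - j + 1) ω ∈ dyadicCube ℓ q.2}|}

theorem card_prod_cubes_le {n ℓ m j : ℕ} (hm : 1 ≤ m) (hj : j ∈ Finset.Icc 1 (n - m)) :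
    Fintype.card ((Fin j → Fin (2 ^ ℓ)) × (Fin (n - m - j + 1) → Fin (2 ^ ℓ))) ≤ 2 ^ (n * ℓ) := by
  have hj' := Finset.mem_Icc.1 hj
  rw [Fintype.card_prod, Fintype.card_fun, Fintype.card_fun, Fintype.card_fin, Fintype.card_fin,
    Fintype.card_fin, ← pow_mul, ← pow_mul, ← pow_add, ← mul_add, mul_comm]
  exact Nat.pow_le_pow_right two_pos (Nat.mul_le_mul_right _ (by omega))

/-- Union bound over at most `2 ^ (n * ℓ)` pairs of cells, with three Chebyshev estimates for each,
at block lengths `n`, `j` and `n - m - j + 1`. -/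
theorem measure_deviationSet_le (hstat : IsStationary μ)
    (hsum : Summable fun m => betaMixing μ (m + 1)) {t n ℓ m j : ℕ} (ht : 0 < t) (hm : 1 ≤ m)
    (hj : j ∈ Finset.Icc 1 (n - m)) {η : ℝ} (hη : 0 < η) :
    μ (deviationSet μ t n ℓ m j η)
      ≤ ENNReal.ofReal (2 ^ (n * ℓ) * (3 * (mixingConst μ / (t * η ^ 2)))) := by
  have hj' := Finset.mem_Icc.1 hj
  have hc : 0 ≤ mixingConst μ / (t * η ^ 2) := div_nonneg (mixingConst_nonneg μ) (by positivity)
  have hq : ∀ q : (Fin j → Fin (2 ^ ℓ)) × (Fin (n - m - j + 1) → Fin (2 ^ ℓ)),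
      μ ({ω | η ≤ |empJoint t n m ω (dyadicCube ℓ q.1) (dyadicCube ℓ q.2)
        - μ.real {ω | block 1 j ω ∈ dyadicCube ℓ q.1 ∧
            block (j + m) (n - m - j + 1) ω ∈ dyadicCube ℓ q.2}|}
    ∪ {ω | η ≤ |empMeasure t ω (dyadicCube ℓ q.1)
        - μ.real {ω | block 1 j ω ∈ dyadicCube ℓ q.1}|}
    ∪ {ω | η ≤ |empMeasure t ω (dyadicCube ℓ q.2)
        - μ.real {ω | block 1 (n - m - j + 1) ω ∈ dyadicCube ℓ q.2}|})
      ≤ ENNReal.ofReal (3 * (mixingConst μ / (t * η ^ 2))) := by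
    intro q
    have h1 := measure_empMeasure_deviation_le hstat hsum
      (measurableSet_dyadicCube q.1) hj'.1 ht hη
    have h2 := measure_empMeasure_deviation_le hstat hsum
      (measurableSet_dyadicCube q.2) (Nat.le_add_left 1 _) ht hη
    have hle : j + m - 1 + (n - m - j + 1) ≤ n := by omega
    have hjn : j ≤ n := by omega
    have hjm : 1 ≤ j + m := by omega
    have h3 := measure_empMeasure_deviation_le hstat hsum (measurableSet_jointSet hle hjn
      (measurableSet_dyadicCube q.1) (measurableSet_dyadicCube q.2)) (by omega) ht hη
    rw [measureReal_block_mem_jointSet hle hjn hjm] at h3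
    simp only [← empJoint_eq_empMeasure hle hjn hjm] at h3
    refine (measure_union_le _ _).trans ((add_le_add ((measure_union_le _ _).trans
      (add_le_add h3 h1)) h2).trans_eq ?_)
    rw [← ENNReal.ofReal_add hc hc, ← ENNReal.ofReal_add (add_nonneg hc hc) hc]
    congr 1
    ring
  refine (measure_iUnion_fintype_le μ _).trans ((Finset.sum_le_sum fun q _ => hq q).trans ?_)
  rw [Finset.sum_const, Finset.card_univ, nsmul_eq_mul,
    ENNReal.ofReal_mul (p := 2 ^ (n * ℓ)) (by positivity)]
  gcongr
  rw [ENNReal.ofReal_pow zero_le_two, ENNReal.ofReal_ofNat]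
  exact_mod_cast card_prod_cubes_le hm hj

/-- Each pair of cells contributes at most `3η`: `η` from the joint frequency and `2η` from the
product. The factor `1/2` leaves `3η/2`, rounded up to `2η`. -/
theorem abs_half_sum_sub_le (hstat : IsStationary μ) {t n ℓ m j : ℕ} (hm : 1 ≤ m)
    (hj : j ∈ Finset.Icc 1 (n - m)) {η : ℝ} {ω : Path} (hω : ω ∉ deviationSet μ t n ℓ m j η) :
    |((1 / 2 : ℝ) * ∑ a : Fin j → Fin (2 ^ ℓ), ∑ b : Fin (n - m - j + 1) → Fin (2 ^ ℓ),
      |empJoint t n m ω (dyadicCube ℓ a) (dyadicCube ℓ b)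
        - empMeasure t ω (dyadicCube ℓ a) * empMeasure t ω (dyadicCube ℓ b)|
      - (1 / 2 : ℝ) * ∑ q, |jointDev μ (quantBlock ℓ 1 j)
      (quantBlock ℓ (j + m) (n - m - j + 1)) q|)| ≤ 2 ^ (n * ℓ) * (2 * η) := by
  simp only [deviationSet, Set.mem_iUnion, Set.mem_union, Set.mem_ofPred_eq, not_exists, not_or,
    not_le] at hω
  have hη : 0 < η := (abs_nonneg _).trans_lt (hω ⟨fun _ => 0, fun _ => 0⟩).1.1
  rw [← Fintype.sum_prod_type' (f := fun (a : Fin j → Fin (2 ^ ℓ))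
    (b : Fin (n - m - j + 1) → Fin (2 ^ ℓ)) =>
      |empJoint t n m ω (dyadicCube ℓ a) (dyadicCube ℓ b)
        - empMeasure t ω (dyadicCube ℓ a) * empMeasure t ω (dyadicCube ℓ b)|),
    ← mul_sub, ← Finset.sum_sub_distrib, abs_mul, abs_of_pos (by norm_num : (0 : ℝ) < 1 / 2)]
  have hterm : ∀ q : (Fin j → Fin (2 ^ ℓ)) × (Fin (n - m - j + 1) → Fin (2 ^ ℓ)),
      |(|empJoint t n m ω (dyadicCube ℓ q.1) (dyadicCube ℓ q.2)
        - empMeasure t ω (dyadicCube ℓ q.1) * empMeasure t ω (dyadicCube ℓ q.2)|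
        - |jointDev μ (quantBlock ℓ 1 j) (quantBlock ℓ (j + m) (n - m - j + 1)) q|)|
      ≤ 3 * η := by
    intro q
    obtain ⟨⟨h1, h2⟩, h3⟩ := hω q
    refine (abs_abs_sub_abs_le _ _).trans ?_
    unfold jointDev
    simp only [quantBlock_eq_iff]
    -- The estimator samples the second cube along blocks starting at time `1`; stationarity moves
    -- its probability to position `j + m`.
    have e : μ.real {ω | block (j + m) (n - m - j + 1) ω ∈ dyadicCube ℓ q.2}
        = μ.real {ω | block 1 (n - m - j + 1) ω ∈ dyadicCube ℓ q.2} := by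
      rw [← measureReal_block_mem hstat (measurableSet_dyadicCube q.2) (j + m - 1),
        Nat.sub_add_cancel (by omega)]
    rw [e]
    have h4 := abs_mul_sub_mul_le (empMeasure_mem_Icc t ω _)
      ⟨measureReal_nonneg, measureReal_le_one⟩ h2.le h3.le
    rw [sub_sub_sub_comm]
    refine (abs_sub _ _).trans ?_
    linarith
  have hS := (Finset.abs_sum_le_sum_abs _ Finset.univ).trans
    (Finset.sum_le_sum fun q (_ : q ∈ Finset.univ) => hterm q)
  rw [Finset.sum_const, Finset.card_univ, nsmul_eq_mul] at hS
  have hcard : (Fintype.card ((Fin j → Fin (2 ^ ℓ)) × (Fin (n - m - j + 1) → Fin (2 ^ ℓ))) : ℝ)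
      ≤ 2 ^ (n * ℓ) := by exact_mod_cast card_prod_cubes_le hm hj
  have := mul_le_mul_of_nonneg_right hcard (by positivity : (0 : ℝ) ≤ 3 * η)
  have hp : (0 : ℝ) ≤ 2 ^ (n * ℓ) * η := by positivity
  linarith

theorem measure_betaHat_deviation_le (hstat : IsStationary μ)
    (hsum : Summable fun m => betaMixing μ (m + 1)) {t n ℓ m : ℕ} (ht : 0 < t) (hm : 1 ≤ m)
    {ρ : ℝ} (hρ : 0 < ρ) :
    μ {ω | ρ < |betaHat t n ℓ ω m - betaCell μ ℓ n m|}
      ≤ ENNReal.ofReal (12 * mixingConst μ * n * 2 ^ (3 * (n * ℓ)) / (t * ρ ^ 2)) := by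
  -- This `η` turns the bound `2 ^ (n * ℓ) * (2 * η)` into `ρ`. Its square costs `4 * 2 ^ (2 * (n *
  -- ℓ))`, whence `12` and the exponent `3 * (n * ℓ)`.
  have hη : 0 < ρ / (2 * 2 ^ (n * ℓ)) := by positivity
  have hsub : {ω | ρ < |betaHat t n ℓ ω m - betaCell μ ℓ n m|}
      ⊆ ⋃ j ∈ Finset.Icc 1 (n - m), deviationSet μ t n ℓ m j (ρ / (2 * 2 ^ (n * ℓ))) := by
    intro ω hω
    by_contra hcon
    simp only [Set.mem_iUnion, not_exists] at hcon
    refine (not_le.2 (Set.mem_ofPred_eq ▸ hω)) ?_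
    refine abs_iSup_sub_iSup_le hρ.le fun j => ?_
    refine (abs_half_sum_sub_le hstat hm j.2 (hcon j.1 j.2)).trans_eq ?_
    field_simp
  refine (measure_mono hsub).trans ((measure_biUnion_finset_le _ _).trans
    ((Finset.sum_le_sum fun j hj => measure_deviationSet_le hstat hsum ht hm hj hη).trans ?_))
  have hK := mixingConst_nonneg μ
  rw [Finset.sum_const, Nat.card_Icc, nsmul_eq_mul, ← ENNReal.ofReal_natCast,
    ← ENNReal.ofReal_mul (Nat.cast_nonneg _)]
  refine ENNReal.ofReal_le_ofReal ?_
  have hn : ((n - m + 1 - 1 : ℕ) : ℝ) ≤ n := Nat.cast_le.2 (by omega)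
  refine (mul_le_mul_of_nonneg_right hn (by positivity)).trans_eq ?_
  have hz : (0 : ℝ) < 2 ^ (n * ℓ) := by positivity
  rw [mul_comm 3 (n * ℓ), pow_mul 2 (n * ℓ) 3]
  generalize (2 : ℝ) ^ (n * ℓ) = z at hz
  field_simp
  ring

end Deviation

/-! ### Numbers of blocks and the Borel–Cantelli argument -/

/-- The union bound costs only a single exponential in `n * ℓ`, which the double exponential in
`Ctilde` absorbs with room to spare. -/
theorem mul_two_pow_le_two_pow (n ℓ : ℕ) (hℓ : 1 ≤ ℓ) :
    12 * n * 2 ^ (3 * (n * ℓ)) ≤ 3 * 2 ^ (2 ^ (2 * n * ℓ + 1) + 2) := by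
  have h1 : n ≤ 2 ^ (n * ℓ) :=
    (Nat.le_mul_of_pos_right n hℓ).trans Nat.lt_two_pow_self.le
  have h2 : 2 * (n * ℓ) ≤ 2 ^ (2 * (n * ℓ)) := Nat.lt_two_pow_self.le
  have h3 : 2 ^ (n * ℓ + 3 * (n * ℓ)) ≤ 2 ^ 2 ^ (2 * n * ℓ + 1) := by
    refine Nat.pow_le_pow_right two_pos ?_
    rw [pow_succ, mul_assoc 2 n ℓ]
    omega
  rw [pow_add] at h3
  calc 12 * n * 2 ^ (3 * (n * ℓ)) ≤ 12 * 2 ^ (n * ℓ) * 2 ^ (3 * (n * ℓ)) := by gcongr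
    _ = 12 * (2 ^ (n * ℓ) * 2 ^ (3 * (n * ℓ))) := by ring
    _ ≤ 12 * 2 ^ 2 ^ (2 * n * ℓ + 1) := by gcongr
    _ = 3 * 2 ^ (2 ^ (2 * n * ℓ + 1) + 2) := by ring

theorem sq_le_two_pow_two_pow (M ℓ : ℕ) (hℓ : 1 ≤ ℓ) : M ^ 2 ≤ 2 ^ 2 ^ (M * ℓ + 1) := by
  have h1 : M ≤ 2 ^ M := Nat.lt_two_pow_self.le
  have h2 : M ≤ M * ℓ := Nat.le_mul_of_pos_right M hℓ
  have h3 : 2 ^ M ≤ 2 ^ (M * ℓ) := Nat.pow_le_pow_right two_pos h2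
  calc M ^ 2 ≤ (2 ^ M) ^ 2 := by gcongr
    _ = 2 ^ (M * 2) := (pow_mul _ _ _).symm
    _ ≤ 2 ^ 2 ^ (M * ℓ + 1) := Nat.pow_le_pow_right two_pos (by rw [pow_succ]; omega)

section BorelCantelli

variable {μ : Measure Path} [IsProbabilityMeasure μ]

/-- The factor `m` of `Ctilde` cancels in `tauTilde`, and the term `2 ^ (m * ℓ + 1)` of the exponent
is simply dropped. -/
theorem measure_betaEst_deviation_le (hstat : IsStationary μ)
    (hsum : Summable fun m => betaMixing μ (m + 1)) {n ℓ m : ℕ} (hℓ : 1 ≤ ℓ) (hm : 1 ≤ m)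
    {ε δ : ℝ} (hε : 0 < ε) (hδ : 0 < δ) :
    μ {ω | ε < |betaHat (tauTilde m ℓ n ε δ) n ℓ ω m - betaCell μ ℓ n m|}
      ≤ ENNReal.ofReal (3 * mixingConst μ * δ) := by
  have hK := mixingConst_nonneg μ
  have hm' : (0 : ℝ) < m := Nat.cast_pos.2 hm
  have hC : 0 < Ctilde m ℓ n / (m * ε ^ 2 * δ) := by unfold Ctilde; positivity
  have hpos : 0 < tauTilde m ℓ n ε δ := Nat.ceil_pos.2 hC
  have hτ := Nat.le_ceil (Ctilde m ℓ n / (m * ε ^ 2 * δ))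
  refine (measure_betaHat_deviation_le hstat hsum hpos hm hε).trans
    (ENNReal.ofReal_le_ofReal ?_)
  change _ ≤ ((tauTilde m ℓ n ε δ : ℕ) : ℝ) at hτ
  set T : ℝ := ((tauTilde m ℓ n ε δ : ℕ) : ℝ)
  have hT : 0 < T := hC.trans_le hτ
  have hτ' : 2 ^ (2 ^ (2 * n * ℓ + 1) + 2) ≤ T * ε ^ 2 * δ := by
    have h1 : Ctilde m ℓ n / (m * ε ^ 2 * δ)
        = 2 ^ (2 ^ (2 * n * ℓ + 1) + 2 ^ (m * ℓ + 1) + 2) / (ε ^ 2 * δ) := by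
      unfold Ctilde
      field_simp
    rw [h1, div_le_iff₀ (by positivity), ← mul_assoc] at hτ
    refine le_trans ?_ hτ
    exact pow_le_pow_right₀ one_le_two (by gcongr; exact Nat.le_add_right _ _)
  have hn : (12 * n * 2 ^ (3 * (n * ℓ)) : ℝ) ≤ 3 * 2 ^ (2 ^ (2 * n * ℓ + 1) + 2) := by
    exact_mod_cast mul_two_pow_le_two_pow n ℓ hℓ
  rw [div_le_iff₀ (by positivity)]
  calc 12 * mixingConst μ * n * 2 ^ (3 * (n * ℓ))
      = mixingConst μ * (12 * n * 2 ^ (3 * (n * ℓ))) := by ring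
    _ ≤ mixingConst μ * (3 * (T * ε ^ 2 * δ)) := mul_le_mul_of_nonneg_left (by linarith) hK
    _ = _ := by ring

/-- A deviation of the sum beyond `ε` forces one of the `M` terms beyond `ε / M`. The union bound
costs `M` and the smaller threshold costs `M ^ 2`. -/
theorem measure_thetaEst_deviation_le (hstat : IsStationary μ)
    (hsum : Summable fun m => betaMixing μ (m + 1)) {n ℓ M : ℕ} (hℓ : 1 ≤ ℓ) (hM : 1 ≤ M)
    {ε δ : ℝ} (hε : 0 < ε) (hδ : 0 < δ) :
    μ {ω | ε < |∑ m ∈ Finset.Icc 1 M, betaHat (kappaTilde M ℓ n ε δ) n ℓ ω m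
        - ∑ m ∈ Finset.Icc 1 M, betaCell μ ℓ n m|}
      ≤ ENNReal.ofReal (3 * mixingConst μ * δ) := by
  have hK := mixingConst_nonneg μ
  have hM' : (0 : ℝ) < M := Nat.cast_pos.2 hM
  have hC : 0 < Ctilde M ℓ n / (ε ^ 2 * δ) := by unfold Ctilde; positivity
  have hpos : 0 < kappaTilde M ℓ n ε δ := Nat.ceil_pos.2 hC
  have hκ := Nat.le_ceil (Ctilde M ℓ n / (ε ^ 2 * δ))
  have hsub : {ω | ε < |∑ m ∈ Finset.Icc 1 M, betaHat (kappaTilde M ℓ n ε δ) n ℓ ω m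
        - ∑ m ∈ Finset.Icc 1 M, betaCell μ ℓ n m|}
      ⊆ ⋃ m ∈ Finset.Icc 1 M,
        {ω | ε / M < |betaHat (kappaTilde M ℓ n ε δ) n ℓ ω m - betaCell μ ℓ n m|} := by
    intro ω hω
    by_contra hcon
    simp only [Set.mem_iUnion, not_exists, Set.mem_ofPred_eq, not_lt] at hcon
    refine (not_le.2 (Set.mem_ofPred_eq ▸ hω)) ?_
    rw [← Finset.sum_sub_distrib]
    refine (Finset.abs_sum_le_sum_abs _ _).trans ((Finset.sum_le_sum hcon).trans_eq ?_)
    rw [Finset.sum_const, Nat.card_Icc, Nat.add_sub_cancel, nsmul_eq_mul]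
    field_simp
  refine (measure_mono hsub).trans ((measure_biUnion_finset_le _ _).trans
    ((Finset.sum_le_sum fun m hm => measure_betaHat_deviation_le hstat hsum hpos
      (Finset.mem_Icc.1 hm).1 (div_pos hε hM')).trans ?_))
  rw [Finset.sum_const, Nat.card_Icc, Nat.add_sub_cancel, nsmul_eq_mul, ← ENNReal.ofReal_natCast,
    ← ENNReal.ofReal_mul (Nat.cast_nonneg _)]
  refine ENNReal.ofReal_le_ofReal ?_
  change _ ≤ ((kappaTilde M ℓ n ε δ : ℕ) : ℝ) at hκ
  set T : ℝ := ((kappaTilde M ℓ n ε δ : ℕ) : ℝ)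
  have hT : 0 < T := hC.trans_le hκ
  -- The first `M` is the prefactor of `Ctilde`, uncancelled in `kappaTilde`; `M ^ 2` is paid for by
  -- `2 ^ 2 ^ (M * ℓ + 1)`.
  have hκ' : M * (M ^ 2 * 2 ^ (2 ^ (2 * n * ℓ + 1) + 2)) ≤ T * ε ^ 2 * δ := by
    rw [div_le_iff₀ (by positivity), ← mul_assoc] at hκ
    refine le_trans ?_ hκ
    have h2 : (M ^ 2 : ℝ) ≤ 2 ^ 2 ^ (M * ℓ + 1) := by
      exact_mod_cast sq_le_two_pow_two_pow M ℓ hℓ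
    unfold Ctilde
    rw [show 2 ^ (2 * n * ℓ + 1) + 2 ^ (M * ℓ + 1) + 2
      = 2 ^ (M * ℓ + 1) + (2 ^ (2 * n * ℓ + 1) + 2) by ring, pow_add _ (2 ^ (M * ℓ + 1))]
    gcongr
  have hn : (12 * n * 2 ^ (3 * (n * ℓ)) : ℝ) ≤ 3 * 2 ^ (2 ^ (2 * n * ℓ + 1) + 2) := by
    exact_mod_cast mul_two_pow_le_two_pow n ℓ hℓ
  rw [div_pow, ← mul_div_assoc, div_le_iff₀ (by positivity)]
  have key : M ^ 3 * (12 * n * 2 ^ (3 * (n * ℓ))) ≤ 3 * (T * ε ^ 2 * δ) := by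
    calc (M ^ 3 * (12 * n * 2 ^ (3 * (n * ℓ))) : ℝ)
        ≤ M ^ 3 * (3 * 2 ^ (2 ^ (2 * n * ℓ + 1) + 2)) := by gcongr
      _ = 3 * (M * (M ^ 2 * 2 ^ (2 ^ (2 * n * ℓ + 1) + 2))) := by ring
      _ ≤ 3 * (T * ε ^ 2 * δ) := by gcongr
  have h5 := mul_le_mul_of_nonneg_left key hK
  have e : 3 * mixingConst μ * δ * (T * (ε ^ 2 / M ^ 2))
      = mixingConst μ * (3 * (T * ε ^ 2 * δ)) / M ^ 2 := by ring
  rw [e, le_div_iff₀ (by positivity)]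
  refine le_trans (le_of_eq ?_) h5
  ring

theorem tsum_ofReal_mul_ne_top {δ : ℕ → ℝ} (hδ_pos : ∀ t, 0 < δ t) (hδ : Summable δ) {c : ℝ}
    (hc : 0 ≤ c) : ∑' t, ENNReal.ofReal (c * δ t) ≠ ∞ := by
  rw [← ENNReal.ofReal_tsum_of_nonneg (fun t => mul_nonneg hc (hδ_pos t).le) (hδ.mul_left c)]
  exact ENNReal.ofReal_ne_top

/-- If the deviations of `f t` from `c t` beyond `ε t → 0` have summable probabilities and
`c t → a`, then `f t → a` almost surely. -/
theorem ae_tendsto_of_measure_deviation_le {μ : Measure Path} {f : ℕ → Path → ℝ} {c ε : ℕ → ℝ} {a : ℝ}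
    {b : ℕ → ℝ≥0∞} (hb : ∑' t, b t ≠ ∞) (hε : Tendsto ε atTop (𝓝 0))
    (hc : Tendsto c atTop (𝓝 a)) (h : ∀ t, μ {ω | ε t < |f t ω - c t|} ≤ b t) :
    ∀ᵐ ω ∂μ, Tendsto (fun t => f t ω) atTop (𝓝 a) := by
  filter_upwards [ae_eventually_notMem (ne_top_of_le_ne_top hb (ENNReal.tsum_le_tsum h))]
    with ω hω
  have h0 : Tendsto (fun t => f t ω - c t) atTop (𝓝 0) := by
    refine squeeze_zero_norm' ?_ hε
    filter_upwards [hω] with t ht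
    rw [Real.norm_eq_abs]
    exact not_lt.1 ht
  simpa using h0.add hc

theorem tendsto_sum_betaCell (hsum : Summable fun m => betaMixing μ (m + 1)) {ℓ n M : ℕ → ℕ}
    (hℓ : Tendsto ℓ atTop atTop) (hn : Tendsto n atTop atTop) (hM : Tendsto M atTop atTop) :
    Tendsto (fun t => ∑ m ∈ Finset.Icc 1 (M t), betaCell μ (ℓ t) (n t) m) atTop
      (𝓝 (∑' m, betaMixing μ (m + 1))) := by
  -- Extending by zero to a full series, with the index shifted to start at `0`, makes dominated
  -- convergence applicable.
  have hrw : ∀ t, ∑ m ∈ Finset.Icc 1 (M t), betaCell μ (ℓ t) (n t) m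
      = ∑' m, if m < M t then betaCell μ (ℓ t) (n t) (m + 1) else 0 := by
    intro t
    rw [tsum_eq_sum (s := Finset.range (M t)) fun m hm =>
      if_neg fun h => hm (Finset.mem_range.2 h)]
    rw [Finset.sum_congr rfl fun m hm => if_pos (Finset.mem_range.1 hm),
      Finset.range_eq_Ico, Finset.sum_Ico_add' (fun m => betaCell μ (ℓ t) (n t) m) 0 (M t) 1]
    rfl
  simp only [hrw]
  refine tendsto_tsum_of_dominated_convergence hsum (fun m => ?_)
    (Eventually.of_forall fun t m => ?_)
  · refine (tendsto_betaCell μ hℓ hn (m + 1)).congr' ?_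
    filter_upwards [hM.eventually_gt_atTop m] with t ht
    rw [if_pos ht]
  · split_ifs
    · rw [Real.norm_of_nonneg (betaCell_nonneg μ _ _ _)]
      exact betaCell_le_betaMixing μ _ _ _
    · simpa using betaMixing_nonneg μ _

theorem summable_betaMixing {μ : Measure Path} (hnorm : betaNorm μ < ∞) :
    Summable fun m => betaMixing μ (m + 1) := by
  have := ENNReal.summable_toReal hnorm.ne
  simpa only [ENNReal.toReal_ofReal (betaMixing_nonneg μ _)] using this

theorem toReal_betaNorm {μ : Measure Path} (hnorm : betaNorm μ < ∞) :
    (betaNorm μ).toReal = ∑' m, betaMixing μ (m + 1) := by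
  unfold betaNorm
  rw [← ENNReal.ofReal_tsum_of_nonneg (fun m => betaMixing_nonneg μ _)
    (summable_betaMixing hnorm), ENNReal.toReal_ofReal (tsum_nonneg fun m => betaMixing_nonneg μ _)]

end BorelCantelli

end BetaMixing

end

theorem mainTheorem6
    (ℓ n M : ℕ → ℕ) (ε δ : ℕ → ℝ)
    (hℓ_pos : ∀ t, 0 < ℓ t) (hℓ_mono : Monotone ℓ) (hℓ : Tendsto ℓ atTop atTop)
    (hn_pos : ∀ t, 0 < n t) (hn_mono : Monotone n) (hn : Tendsto n atTop atTop)
    (hM_pos : ∀ t, 0 < M t) (hM_mono : Monotone M) (hM : Tendsto M atTop atTop)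
    (hδ_pos : ∀ t, 0 < δ t) (hδ : Summable δ)
    (hε_pos : ∀ t, 0 < ε t) (hε : Tendsto ε atTop (𝓝 0))
    (μ : Measure BetaMixing.Path) [IsProbabilityMeasure μ]
    (hstat : BetaMixing.IsStationary μ) (hmix : BetaMixing.IsBetaMixing μ)
    (hnorm : BetaMixing.betaNorm μ < ∞) :
    (∀ m : ℕ, 1 ≤ m → ∀ᵐ ω ∂μ,
      Tendsto (fun t => BetaMixing.betaEst ℓ n ε δ t ω m) atTop
        (𝓝 (BetaMixing.betaMixing μ m))) ∧
    (∀ᵐ ω ∂μ,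
      Tendsto (fun t => BetaMixing.thetaEst ℓ n M ε δ t ω) atTop
        (𝓝 (BetaMixing.betaNorm μ).toReal)) := by
  have hsum := BetaMixing.summable_betaMixing hnorm
  -- Both estimators obey the same bound `3 * mixingConst μ * δ t`, so one summability statement
  -- serves the two Borel–Cantelli arguments.
  have hb := BetaMixing.tsum_ofReal_mul_ne_top hδ_pos hδ
    (mul_nonneg zero_le_three (BetaMixing.mixingConst_nonneg μ))
  constructor
  · intro m hm
    exact BetaMixing.ae_tendsto_of_measure_deviation_le hb hε
      (BetaMixing.tendsto_betaCell μ hℓ hn m) fun t =>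
        BetaMixing.measure_betaEst_deviation_le hstat hsum (hℓ_pos t) hm (hε_pos t) (hδ_pos t)
  · rw [BetaMixing.toReal_betaNorm hnorm]
    exact BetaMixing.ae_tendsto_of_measure_deviation_le hb hε
      (BetaMixing.tendsto_sum_betaCell hsum hℓ hn hM) fun t =>
        BetaMixing.measure_thetaEst_deviation_le hstat hsum (hℓ_pos t) (hM_pos t) (hε_pos t)
          (hδ_pos t)
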